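/- Let $d\ge 1$ and, for $n\ge 1$, let $V_n=\mathbb{Z}^d\cap[1,n]^d$. Let $(g_x)_{x\in V_n}$ be independent standard Gaussian random variables (the disorder), with expectation denoted by $\mathbb{E}$. For $\beta,h>0$, the random field Ising model on $V_n$ with free boundary condition is the random probability measure (Gibbs measure) on $\{-1,1\}^{V_n}$ giving $\sigma$ the mass $$\frac{1}{Z_n(\beta,h)}\exp\Bigl(\beta\sum_{\langle xy\rangle}\sigma_x\sigma_y+h\sum_{x\in V_n}g_x\sigma_x\Bigr),$$ where the first sum is over unordered pairs of nearest neighbours $x,y\in V_n$ and $Z_n(\beta,h)$ is the normalizing constant. Let $\langle\cdot\rangle$ denote averaging over independent configurations $\sigma^1,\sigma^2$ drawn from the Gibbs measure with the same disorder, and let $R_{1,2}=|V_n|^{-1}\sum_{x\in V_n}\sigma^1_x\sigma^2_x$. Then for all $\beta,h>0$ the limit $p(\beta,h)=\lim_{n\to\infty}|V_n|^{-1}\,\mathbb{E}\log Z_n(\beta,h)$ exists and is finite. Let $A$ be the set of all $(\beta,h)\in(0,\infty)^2$ such that $t\mapsto p(\beta,t)$ is not differentiable at $t=h$. Then $A$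 has Lebesgue measure zero, for every $\beta$ the set $\{h:(\beta,h)\in A\}$ is countable, and for every $(\beta,h)\in(0,\infty)^2\setminus A$ there is a constant $q_{\beta,h}\in[-1,1]$ such that $$\lim_{n\to\infty}\mathbb{E}\bigl\langle(R_{1,2}-q_{\beta,h})^2\bigr\rangle=0.$$ -/

import Mathlib

open MeasureTheory ProbabilityTheory Filter Topology

namespace RFIM

/-- The box `V_n = ℤ^d ∩ [1,n]^d`. -/
noncomputable def box (d n : ℕ) : Finset (Fin d → ℤ) :=
  Fintype.piFinset fun _ => Finset.Icc (1 : ℤ) (n : ℤ)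

/-- The nearest-neighbour graph on `V_n` (free boundary: only bonds inside the box). -/
def boxGraph (d n : ℕ) : SimpleGraph (box d n) where
  Adj x y := ∑ i, |x.1 i - y.1 i| = 1
  symm := ⟨fun x y h => by simpa only [abs_sub_comm] using h⟩
  loopless := ⟨fun x h => by simp at h⟩

instance (d n : ℕ) : DecidableRel (boxGraph d n).Adj := fun x y =>
  inferInstanceAs (Decidable (∑ i, |x.1 i - y.1 i| = 1))

/-- Spin configurations `{-1,1}^{V_n}`; `ℤˣ` is the two-element set `{1,-1}`. -/
abbrev Config (d n : ℕ) : Type := box d n → ℤˣ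

/-- The real value `σ_x ∈ {-1,1}` of the spin at `x`. -/
def spin {d n : ℕ} (σ : Config d n) (x : box d n) : ℝ := ((σ x : ℤ) : ℝ)

/-- The product `σ_x σ_y` for an unordered pair `{x,y}`. -/
def bond {d n : ℕ} (σ : Config d n) : Sym2 (box d n) → ℝ :=
  Sym2.lift ⟨fun x y => spin σ x * spin σ y, fun _ _ => mul_comm _ _⟩

/-- The exponent `β ∑_{⟨xy⟩} σ_x σ_y + h ∑_x g_x σ_x`; each bond is counted once. -/
noncomputable def energy {d n : ℕ} (β h : ℝ) (g : box d n → ℝ) (σ : Config d n) : ℝ :=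
  β * (∑ e ∈ (boxGraph d n).edgeFinset, bond σ e) + h * (∑ x, g x * spin σ x)

/-- The partition function `Z_n(β,h)`. -/
noncomputable def partitionFn {d n : ℕ} (β h : ℝ) (g : box d n → ℝ) : ℝ :=
  ∑ σ : Config d n, Real.exp (energy β h g σ)

/-- The mass that the Gibbs measure with disorder `g` gives to `σ`. -/
noncomputable def gibbs {d n : ℕ} (β h : ℝ) (g : box d n → ℝ) (σ : Config d n) : ℝ :=
  Real.exp (energy β h g σ) / partitionFn β h g

/-- The average `⟨f(σ¹,σ²)⟩` over two independent replicas drawn from the Gibbs measure. -/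
noncomputable def replicaAvg {d n : ℕ} (β h : ℝ) (g : box d n → ℝ)
    (f : Config d n → Config d n → ℝ) : ℝ :=
  ∑ σ₁ : Config d n, ∑ σ₂ : Config d n, f σ₁ σ₂ * (gibbs β h g σ₁ * gibbs β h g σ₂)

/-- The overlap `R_{1,2} = |V_n|⁻¹ ∑_x σ¹_x σ²_x`. -/
noncomputable def overlap {d n : ℕ} (σ₁ σ₂ : Config d n) : ℝ :=
  (∑ x, spin σ₁ x * spin σ₂ x) / ((box d n).card : ℝ)

/-- The law of the disorder on `V_n`: independent standard Gaussian variables. -/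
noncomputable def disorder (d n : ℕ) : Measure (box d n → ℝ) :=
  Measure.pi fun _ => gaussianReal 0 1

/-- The mean free energy per site `p_n(β,h) = E(log Z_n(β,h)) / |V_n|`. -/
noncomputable def meanFreeEnergy (d n : ℕ) (β h : ℝ) : ℝ :=
  ∫ g, Real.log (partitionFn β h g) / ((box d n).card : ℝ) ∂(disorder d n)

/-- `E⟨(R_{1,2} - q)²⟩`. -/
noncomputable def overlapDeviation (d n : ℕ) (β h q : ℝ) : ℝ :=
  ∫ g, replicaAvg β h g (fun σ₁ σ₂ => (overlap σ₁ σ₂ - q) ^ 2) ∂(disorder d n)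

end RFIM

/-!
The interaction is ferromagnetic, so by the FKG inequality all truncated correlations are
nonnegative. The replica variance of the overlap is therefore at most twice the total truncated
correlation divided by `|V|²`, and the disorder average of that total is at most of order
`|V|^(3/2)` by Gaussian integration by parts: the overlap is close to its Gibbs mean `Q`.

To see that `Q` is also asymptotically free of the disorder, use the field energy
`M = |V|⁻¹ ∑ x, g x ⟨σ_x⟩`, the derivative in `h` of the free energy. The free energy is convex in
`h` and, by the Efron-Stein inequality, has variance `O(1 / |V|)`; hence `M` converges in `L¹` to
`p'(h)` wherever the limit `p` is differentiable. Put `q = 1 - p'(h) / h`. Integration by parts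
gives `E[M (Q - q)] = h E[(1 - Q) (Q - q)]` up to a vanishing error, so that up to this error
`h E[(Q - q)²] = -E[(M - h (1 - q)) (Q - q)]`, which tends to zero.

The limit exists because cutting a box of side `k m` into blocks of side `m` changes the free energy
per site by at most `|β| d / m`. It is jointly convex in the two parameters, so the exceptional set
is measurable with countable sections.
-/

namespace RandomField

section GibbsMean

variable {ι : Type*} [Fintype ι]

/-- The mean of the observable `f` under the Gibbs measure on a finite set whose atoms have
masses proportional to `exp (a i)`, as a linear functional of `f`. -/
noncomputable def gibbsMean (a : ι → ℝ) : (ι → ℝ) →ₗ[ℝ] ℝ :=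
  ∑ i, (Real.exp (a i) / ∑ j, Real.exp (a j)) • LinearMap.proj i

/-- The covariance of two observables under the Gibbs measure with exponent `a`. -/
noncomputable def gibbsCov (a f g : ι → ℝ) : ℝ :=
  gibbsMean a (f * g) - gibbsMean a f * gibbsMean a g

/-- The logarithm of the partition function of the Gibbs measure with exponent `a`. -/
noncomputable def logSumExp (a : ι → ℝ) : ℝ :=
  Real.log (∑ i, Real.exp (a i))

lemma gibbsMean_apply (a f : ι → ℝ) :
    gibbsMean a f = (∑ i, f i * Real.exp (a i)) / ∑ i, Real.exp (a i) := by
  simp only [gibbsMean, LinearMap.sum_apply, LinearMap.smul_apply, LinearMap.proj_apply,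
    smul_eq_mul, Finset.sum_div]
  exact Finset.sum_congr rfl fun i _ => by ring

lemma gibbsMean_mono (a : ι → ℝ) : Monotone (gibbsMean a) := by
  intro f g hfg
  simp only [gibbsMean_apply]
  gcongr with i
  exact hfg i

variable [Nonempty ι]

lemma sum_exp_pos (a : ι → ℝ) : 0 < ∑ i, Real.exp (a i) :=
  Finset.sum_pos (fun _ _ => Real.exp_pos _) Finset.univ_nonempty

lemma gibbsMean_const (a : ι → ℝ) (c : ℝ) : gibbsMean a (fun _ => c) = c := by
  rw [gibbsMean_apply, ← Finset.mul_sum, mul_div_cancel_right₀ _ (sum_exp_pos a).ne']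

lemma abs_gibbsMean_le (a : ι → ℝ) {f : ι → ℝ} {C : ℝ} (hf : ∀ i, |f i| ≤ C) :
    |gibbsMean a f| ≤ C := by
  refine abs_le.2 ⟨?_, ?_⟩
  · exact (gibbsMean_const a (-C)).ge.trans (gibbsMean_mono a fun i => (abs_le.1 (hf i)).1)
  · exact (gibbsMean_mono a fun i => (abs_le.1 (hf i)).2).trans (gibbsMean_const a C).le

lemma continuous_gibbsMean (f : ι → ℝ) : Continuous fun a : ι → ℝ => gibbsMean a f := by
  simp only [gibbsMean_apply]
  exact Continuous.div (by fun_prop) (by fun_prop) fun a => (sum_exp_pos a).ne'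

lemma exp_gibbsMean_le (a f : ι → ℝ) :
    Real.exp (gibbsMean a f) ≤ gibbsMean a fun i => Real.exp (f i) := by
  have jensen := convexOn_exp.map_sum_le (t := Finset.univ) (p := f)
    (w := fun i => Real.exp (a i) / ∑ j, Real.exp (a j)) (fun i _ => by positivity)
    (by rw [← Finset.sum_div, div_self (sum_exp_pos a).ne']) (fun _ _ => Set.mem_univ _)
  simpa [gibbsMean] using jensen

lemma gibbsMean_sub_le_logSumExp_sub (a b : ι → ℝ) :
    gibbsMean a (b - a) ≤ logSumExp b - logSumExp a := by
  have ratio : (gibbsMean a fun i => Real.exp ((b - a) i)) =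
      (∑ i, Real.exp (b i)) / ∑ i, Real.exp (a i) := by
    simp only [gibbsMean_apply, ← Real.exp_add, Pi.sub_apply, sub_add_cancel]
  rw [logSumExp, logSumExp, ← Real.log_div (sum_exp_pos b).ne' (sum_exp_pos a).ne', ← ratio,
    Real.le_log_iff_exp_le (ratio ▸ div_pos (sum_exp_pos b) (sum_exp_pos a))]
  exact exp_gibbsMean_le a (b - a)

lemma abs_logSumExp_sub_le {a b : ι → ℝ} {C : ℝ} (h : ∀ i, |a i - b i| ≤ C) :
    |logSumExp a - logSumExp b| ≤ C := by
  have hba : |gibbsMean b (a - b)| ≤ C := abs_gibbsMean_le b h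
  have hab : |gibbsMean a (b - a)| ≤ C :=
    abs_gibbsMean_le a fun i => (abs_sub_comm _ _).trans_le (h i)
  have := gibbsMean_sub_le_logSumExp_sub a b
  have := gibbsMean_sub_le_logSumExp_sub b a
  exact abs_le.2 ⟨by linarith [(abs_le.1 hba).1], by linarith [(abs_le.1 hab).1]⟩

lemma convexOn_logSumExp : ConvexOn ℝ Set.univ (logSumExp : (ι → ℝ) → ℝ) := by
  refine ⟨convex_univ, fun a _ b _ s t hs ht hst => ?_⟩
  set c := s • a + t • b with hc
  have gradient_sum : s * gibbsMean c (a - c) + t * gibbsMean c (b - c) = 0 := by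
    have : s • (a - c) + t • (b - c) = 0 := by
      rw [smul_sub, smul_sub, sub_add_sub_comm, ← add_smul, hst, one_smul, hc, sub_self]
    simpa only [map_add, map_smul, smul_eq_mul, map_zero] using congrArg (gibbsMean c) this
  have := mul_le_mul_of_nonneg_left (gibbsMean_sub_le_logSumExp_sub c a) hs
  have := mul_le_mul_of_nonneg_left (gibbsMean_sub_le_logSumExp_sub c b) ht
  have : (s + t) * logSumExp c = logSumExp c := by rw [hst, one_mul]
  simp only [smul_eq_mul]
  linarith

lemma hasDerivAt_gibbsMean {a : ℝ → ι → ℝ} {a' : ι → ℝ} {t : ℝ} (ha : HasDerivAt a a' t)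
    (f : ι → ℝ) : HasDerivAt (fun s => gibbsMean (a s) f) (gibbsCov (a t) f a') t := by
  have exp_deriv (i : ι) :
      HasDerivAt (fun s => Real.exp (a s i)) (Real.exp (a t i) * a' i) t :=
    (hasDerivAt_pi.1 ha i).exp
  have quotient := (HasDerivAt.fun_sum fun i (_ : i ∈ Finset.univ) =>
    (exp_deriv i).const_mul (f i)).fun_div
    (HasDerivAt.fun_sum fun i (_ : i ∈ Finset.univ) => exp_deriv i) (sum_exp_pos (a t)).ne'
  simp only [gibbsMean_apply, gibbsCov]
  refine quotient.congr_deriv ?_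
  have hZ := (sum_exp_pos (a t)).ne'
  have h1 : ∑ i, f i * (Real.exp (a t i) * a' i) = ∑ i, (f * a') i * Real.exp (a t i) :=
    Finset.sum_congr rfl fun i _ => by rw [Pi.mul_apply]; ring
  have h2 : ∑ i, Real.exp (a t i) * a' i = ∑ i, a' i * Real.exp (a t i) :=
    Finset.sum_congr rfl fun i _ => mul_comm _ _
  rw [h1, h2]
  field_simp

lemma abs_gibbsCov_le (a : ι → ℝ) {f g : ι → ℝ} {C D : ℝ} (hf : ∀ i, |f i| ≤ C)
    (hg : ∀ i, |g i| ≤ D) : |gibbsCov a f g| ≤ 2 * (C * D) := by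
  have hC : 0 ≤ C := (abs_nonneg _).trans (hf (Classical.arbitrary ι))
  have hfg : |gibbsMean a (f * g)| ≤ C * D := abs_gibbsMean_le a fun i => by
    rw [Pi.mul_apply, abs_mul]
    exact mul_le_mul (hf i) (hg i) (abs_nonneg _) hC
  have hmul : |gibbsMean a f * gibbsMean a g| ≤ C * D := by
    rw [abs_mul]
    exact mul_le_mul (abs_gibbsMean_le a hf) (abs_gibbsMean_le a hg) (abs_nonneg _) hC
  exact (abs_sub _ _).trans (by linarith)

end GibbsMean

section FKG

/-- Supermodularity of the exponent is the lattice condition of the FKG inequality for the Gibbs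
measure. -/
def Supermodular {α : Type*} [Lattice α] (H : α → ℝ) : Prop :=
  ∀ a b, H a + H b ≤ H (a ⊓ b) + H (a ⊔ b)

variable {α : Type*} [Fintype α] [Nonempty α]

lemma gibbsCov_add_const (a f g : α → ℝ) (C D : ℝ) :
    gibbsCov a (f + fun _ => C) (g + fun _ => D) = gibbsCov a f g := by
  have expand : (f + fun _ => C) * (g + fun _ => D) = f * g + D • f + C • g + fun _ => C * D := by
    ext i
    simp only [Pi.add_apply, Pi.mul_apply, Pi.smul_apply, smul_eq_mul]
    ring
  rw [gibbsCov, expand]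
  simp only [map_add, map_smul, gibbsMean_const, smul_eq_mul, gibbsCov]
  ring

lemma gibbsCov_nonneg [DistribLattice α] {a f g : α → ℝ} (ha : Supermodular a)
    (hf : Monotone f) (hg : Monotone g) : 0 ≤ gibbsCov a f g := by
  obtain ⟨C, hC⟩ := (Set.finite_range fun i => -f i).bddAbove
  obtain ⟨D, hD⟩ := (Set.finite_range fun i => -g i).bddAbove
  have fkg_ineq := fkg (f + fun _ => C) (g + fun _ => D) (fun i => Real.exp (a i))
    (fun i => (Real.exp_pos _).le) (fun i => neg_le_iff_add_nonneg'.1 (hC ⟨i, rfl⟩))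
    (fun i => neg_le_iff_add_nonneg'.1 (hD ⟨i, rfl⟩)) (hf.add_const C) (hg.add_const D)
    (fun i j => by simpa only [← Real.exp_add, Real.exp_le_exp] using ha i j)
  have hZ := sum_exp_pos a
  simp only [mul_comm (Real.exp _)] at fkg_ineq
  rw [← gibbsCov_add_const a f g C D, gibbsCov, gibbsMean_apply, gibbsMean_apply, gibbsMean_apply,
    sub_nonneg, div_mul_div_comm]
  exact (div_le_div_of_nonneg_right fkg_ineq (mul_pos hZ hZ).le).trans_eq
    (mul_div_mul_left _ _ hZ.ne')

end FKG

section Resampling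

variable {ι : Type*} [DecidableEq ι] {X : ι → Type*} [∀ i, MeasurableSpace (X i)]
  (μ : ∀ i, Measure (X i))

/-- The function `f` of independent variables with laws `μ i`, averaged over the `i`-th one. -/
noncomputable def averageCoord (i : ι) (f : (∀ i, X i) → ℝ) (g : ∀ i, X i) : ℝ :=
  ∫ t, f (Function.update g i t) ∂μ i

lemma dependsOn_averageCoord {i : ι} {s : Finset ι} {f : (∀ i, X i) → ℝ}
    (hf : DependsOn f (insert i s : Finset ι)) : DependsOn (averageCoord μ i f) s := by
  intro g g' h
  refine integral_congr_ae (ae_of_all _ fun t => hf fun j hj => ?_)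
  rcases eq_or_ne j i with rfl | hji
  · simp only [Function.update_self]
  · simp only [Function.update_of_ne hji]
    exact h j (Finset.mem_of_mem_insert_of_ne hj hji)

variable [Fintype ι] [∀ i, IsProbabilityMeasure (μ i)]

lemma measurePreserving_update (i : ι) :
    MeasurePreserving (fun p : (∀ j, X j) × X i => Function.update p.1 i p.2)
      ((Measure.pi μ).prod (μ i)) (Measure.pi μ) := by
  refine ⟨measurable_update', (Measure.pi_eq fun s hs => ?_).symm⟩
  have preimage_pi : (fun p : (∀ j, X j) × X i => Function.update p.1 i p.2) ⁻¹' Set.univ.pi s =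
      Set.univ.pi (Function.update s i Set.univ) ×ˢ s i := by
    ext ⟨g, t⟩
    simp only [Set.mem_preimage, Set.mem_univ_pi, Set.mem_prod]
    refine ⟨fun h => ⟨fun j => ?_, by simpa using h i⟩, fun h j => ?_⟩ <;>
      rcases eq_or_ne j i with rfl | hj
    · simp
    · simpa [hj] using h j
    · simpa using h.2
    · simpa [hj] using h.1 j
  rw [Measure.map_apply measurable_update' (MeasurableSet.univ_pi hs), preimage_pi,
    Measure.prod_prod, Measure.pi_pi, ← Finset.mul_prod_erase _ _ (Finset.mem_univ i),
    ← Finset.mul_prod_erase _ (fun j => μ j (s j)) (Finset.mem_univ i), Function.update_self,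
    measure_univ, one_mul, mul_comm]
  congr 1
  exact Finset.prod_congr rfl fun j hj => by rw [Function.update_of_ne (Finset.ne_of_mem_erase hj)]

variable {μ} {f : (∀ i, X i) → ℝ}

lemma integrable_comp_update (i : ι) (hf : Integrable f (Measure.pi μ)) :
    Integrable (fun p : (∀ j, X j) × X i => f (Function.update p.1 i p.2))
      ((Measure.pi μ).prod (μ i)) :=
  (measurePreserving_update μ i).integrable_comp_of_integrable hf

lemma integral_averageCoord (i : ι) (hf : Integrable f (Measure.pi μ)) :
    ∫ g, averageCoord μ i f g ∂Measure.pi μ = ∫ g, f g ∂Measure.pi μ := by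
  have hupdate := measurePreserving_update μ i
  calc ∫ g, averageCoord μ i f g ∂Measure.pi μ
      = ∫ p, f (Function.update p.1 i p.2) ∂(Measure.pi μ).prod (μ i) :=
        (integral_prod _ (integrable_comp_update i hf)).symm
    _ = ∫ g, f g ∂Measure.pi μ := by
        rw [← integral_map hupdate.aemeasurable (by
          rw [hupdate.map_eq]; exact hf.aestronglyMeasurable), hupdate.map_eq]

lemma integrable_averageCoord (i : ι) (hf : Integrable f (Measure.pi μ)) :
    Integrable (averageCoord μ i f) (Measure.pi μ) :=
  (integrable_comp_update i hf).integral_prod_left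

lemma ae_memLp_two_update (i : ι) (hf : MemLp f 2 (Measure.pi μ)) :
    ∀ᵐ g ∂Measure.pi μ, MemLp (fun t => f (Function.update g i t)) 2 (μ i) := by
  filter_upwards [(hf.comp_measurePreserving
    (measurePreserving_update μ i)).aestronglyMeasurable.prodMk_left,
    (integrable_comp_update i hf.integrable_sq).prod_right_ae] with g hmeas hsq
  exact (memLp_two_iff_integrable_sq hmeas).2 hsq

/-- The law of total variance, for conditioning on all coordinates but the `i`-th. -/
lemma variance_eq_integral_variance_add (i : ι) (hf : MemLp f 2 (Measure.pi μ))
    (havg : MemLp (averageCoord μ i f) 2 (Measure.pi μ)) :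
    Var[f; Measure.pi μ] = ∫ g, Var[fun t => f (Function.update g i t); μ i] ∂Measure.pi μ +
      Var[averageCoord μ i f; Measure.pi μ] := by
  have section_variance : ∫ g, Var[fun t => f (Function.update g i t); μ i] ∂Measure.pi μ =
      ∫ g, (averageCoord μ i (f ^ 2) g - averageCoord μ i f g ^ 2) ∂Measure.pi μ := by
    refine integral_congr_ae ?_
    filter_upwards [ae_memLp_two_update i hf] with g hg
    rw [variance_eq_sub hg]
    rfl
  have hsq : Integrable (f ^ 2) (Measure.pi μ) := hf.integrable_sq
  rw [section_variance, integral_sub (integrable_averageCoord i hsq) havg.integrable_sq,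
    integral_averageCoord i hsq, variance_eq_sub hf, variance_eq_sub havg,
    integral_averageCoord i (hf.integrable one_le_two)]
  simp only [Pi.pow_apply]
  ring

end Resampling

section Variance

/-- `f` is `c`-Lipschitz for the `ℓ¹` distance. -/
def L1Lipschitz {ι : Type*} [Fintype ι] (c : ℝ) (f : (ι → ℝ) → ℝ) : Prop :=
  ∀ g g', |f g - f g'| ≤ c * ∑ i, |g i - g' i|

lemma memLp_of_abs_sub_le {α : Type*} [MeasurableSpace α] {ν : Measure α}
    [IsProbabilityMeasure ν] {u v : α → ℝ} {a : ℝ} (hu : AEStronglyMeasurable u ν)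
    (hv : MemLp v 2 ν) (huv : ∀ x, |u x - a| ≤ v x) : MemLp u 2 ν := by
  have hsub : MemLp (fun x => u x - a) 2 ν :=
    hv.mono (hu.sub aestronglyMeasurable_const) (ae_of_all _ fun x =>
      (huv x).trans (le_abs_self _))
  exact (memLp_congr_ae (ae_of_all _ fun x => sub_add_cancel (u x) a)).1 (hsub.add (memLp_const a))

lemma variance_le_of_abs_sub_le {ν : Measure ℝ} [IsProbabilityMeasure ν] (hν : MemLp id 2 ν)
    {u : ℝ → ℝ} {c : ℝ} (hu : AEStronglyMeasurable u ν)
    (hc : ∀ s t, |u s - u t| ≤ c * |s - t|) : Var[u; ν] ≤ c ^ 2 * Var[id; ν] := by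
  set m := ∫ t, t ∂ν
  have hcentre : MemLp (fun t => t - m) 2 ν := hν.sub (memLp_const m)
  rw [← variance_sub_const hu (u m), variance_eq_integral aemeasurable_id, ← integral_const_mul]
  refine (variance_le_expectation_sq (hu.sub aestronglyMeasurable_const)).trans
    (integral_mono_of_nonneg (ae_of_all _ fun t => sq_nonneg _) (hcentre.integrable_sq.const_mul _)
      (ae_of_all _ fun t => ?_))
  calc (u t - u m) ^ 2 = |u t - u m| ^ 2 := (sq_abs _).symm
    _ ≤ (c * |t - m|) ^ 2 := by gcongr; exact hc t m
    _ = c ^ 2 * (id t - m) ^ 2 := by rw [mul_pow, sq_abs, id]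

variable {ι : Type*} [Fintype ι] {c : ℝ} {f : (ι → ℝ) → ℝ}

lemma L1Lipschitz.continuous (hf : L1Lipschitz c f) : Continuous f := by
  refine continuous_iff_continuousAt.2 fun g => tendsto_iff_dist_tendsto_zero.2 ?_
  have modulus : Continuous fun g' : ι → ℝ => c * ∑ i, |g' i - g i| := by fun_prop
  refine squeeze_zero (fun _ => dist_nonneg) (fun g' => hf g' g) ?_
  simpa using modulus.tendsto g

lemma L1Lipschitz.memLp {μ : ι → Measure ℝ} [∀ i, IsProbabilityMeasure (μ i)]
    (hμ : ∀ i, MemLp id 2 (μ i)) (hf : L1Lipschitz c f) : MemLp f 2 (Measure.pi μ) := by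
  have norm_memLp : MemLp (fun g : ι → ℝ => c * ∑ i, |g i|) 2 (Measure.pi μ) :=
    (memLp_finsetSum Finset.univ fun i _ =>
      ((hμ i).comp_measurePreserving (measurePreserving_eval μ i)).abs).const_mul c
  exact memLp_of_abs_sub_le hf.continuous.aestronglyMeasurable norm_memLp fun g => by
    simpa using hf g 0

lemma L1Lipschitz.abs_update_sub_le [DecidableEq ι] (hf : L1Lipschitz c f) (i : ι) (g : ι → ℝ)
    (s t : ℝ) :
    |f (Function.update g i s) - f (Function.update g i t)| ≤ c * |s - t| := by
  refine (hf _ _).trans_eq ?_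
  rw [Finset.sum_eq_single i (fun j _ hj => by simp [hj]) (by simp), Function.update_self,
    Function.update_self]

lemma L1Lipschitz.continuous_update [DecidableEq ι] (hf : L1Lipschitz c f) (i : ι)
    (g : ι → ℝ) : Continuous fun t => f (Function.update g i t) :=
  hf.continuous.comp (continuous_const.update i continuous_id)

variable {μ : ι → Measure ℝ} [∀ i, IsProbabilityMeasure (μ i)]

lemma L1Lipschitz.integrable_update [DecidableEq ι] (hμ : ∀ i, MemLp id 2 (μ i))
    (hf : L1Lipschitz c f) (i : ι) (g : ι → ℝ) :
    Integrable (fun t => f (Function.update g i t)) (μ i) := by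
  have hmeas := (hf.continuous_update i g).aestronglyMeasurable (μ := μ i)
  exact (memLp_of_abs_sub_le hmeas ((hμ i).abs.const_mul c) fun t => by
    simpa using hf.abs_update_sub_le i g t 0).integrable one_le_two

lemma L1Lipschitz.averageCoord [DecidableEq ι] (hμ : ∀ i, MemLp id 2 (μ i)) (hc : 0 ≤ c)
    (hf : L1Lipschitz c f) (i : ι) : L1Lipschitz c (averageCoord μ i f) := by
  intro g g'
  rw [RandomField.averageCoord, RandomField.averageCoord,
    ← integral_sub (hf.integrable_update hμ i g) (hf.integrable_update hμ i g')]
  have section_bound (t : ℝ) :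
      ‖f (Function.update g i t) - f (Function.update g' i t)‖ ≤ c * ∑ j, |g j - g' j| := by
    refine (hf _ _).trans (mul_le_mul_of_nonneg_left (Finset.sum_le_sum fun j _ => ?_) hc)
    rcases eq_or_ne j i with rfl | hj
    · simp
    · simp [hj]
  simpa using norm_integral_le_of_norm_le_const (μ := μ i) (ae_of_all _ section_bound)

lemma L1Lipschitz.variance_le_of_dependsOn (hμ : ∀ i, MemLp id 2 (μ i)) (hc : 0 ≤ c)
    (s : Finset ι) (hf : L1Lipschitz c f) (hs : DependsOn f s) :
    Var[f; Measure.pi μ] ≤ c ^ 2 * ∑ i ∈ s, Var[id; μ i] := by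
  classical
  induction s using Finset.induction_on generalizing f with
  | empty =>
    have hconst : f = fun _ => f 0 := funext fun g => hs fun i hi => absurd hi (by simp)
    rw [hconst, variance_eq_integral aemeasurable_const]
    simp
  | insert i s hi ih =>
    have havg := hf.averageCoord hμ hc i
    have section_bound :
        ∫ g, Var[fun t => f (Function.update g i t); μ i] ∂Measure.pi μ ≤ c ^ 2 * Var[id; μ i] :=
      (integral_mono_of_nonneg (ae_of_all _ fun g => variance_nonneg _ _) (integrable_const _)
        (ae_of_all _ fun g => variance_le_of_abs_sub_le (hμ i)
          (hf.continuous_update i g).aestronglyMeasurable (hf.abs_update_sub_le i g))).trans_eq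
        (by simp)
    rw [variance_eq_integral_variance_add i (hf.memLp hμ) (havg.memLp hμ), Finset.sum_insert hi,
      mul_add]
    exact add_le_add section_bound (ih havg (dependsOn_averageCoord μ hs))

lemma L1Lipschitz.variance_le (hμ : ∀ i, MemLp id 2 (μ i)) (hc : 0 ≤ c) (hf : L1Lipschitz c f) :
    Var[f; Measure.pi μ] ≤ c ^ 2 * ∑ i, Var[id; μ i] := by
  exact hf.variance_le_of_dependsOn hμ hc Finset.univ fun g g' h =>
    congrArg f (funext fun i => h i (Finset.mem_univ i))

lemma integral_abs_sub_integral_le_sqrt_variance {Ω : Type*} [MeasurableSpace Ω] {ν : Measure Ω}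
    [IsProbabilityMeasure ν] {Y : Ω → ℝ} (hY : MemLp Y 2 ν) :
    ∫ ω, |Y ω - ∫ ω', Y ω' ∂ν| ∂ν ≤ Real.sqrt Var[Y; ν] := by
  set m := ∫ ω', Y ω' ∂ν
  have habs : MemLp (fun ω => |Y ω - m|) 2 ν := (hY.sub (memLp_const m)).abs
  have jensen := variance_nonneg (fun ω => |Y ω - m|) ν
  rw [variance_eq_sub habs] at jensen
  simp only [Pi.pow_apply, sq_abs, ← variance_eq_integral hY.aestronglyMeasurable.aemeasurable,
    m, sub_nonneg] at jensen
  exact Real.le_sqrt_of_sq_le jensen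

end Variance

section Gaussian

lemma hasDerivAt_gaussianPDFReal (m : ℝ) {v : NNReal} (hv : v ≠ 0) (x : ℝ) :
    HasDerivAt (gaussianPDFReal m v) (-((x - m) / v * gaussianPDFReal m v x)) x := by
  have hv' : (v : ℝ) ≠ 0 := NNReal.coe_ne_zero.2 hv
  have exponent : HasDerivAt (fun x : ℝ => -(x - m) ^ 2 / (2 * v)) (-((x - m) / v)) x := by
    refine (((((hasDerivAt_id x).sub_const m).pow 2).neg).div_const (2 * (v : ℝ))).congr_deriv ?_
    simp only [id]
    field_simp
    ring
  rw [gaussianPDFReal_def]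
  exact (exponent.exp.const_mul _).congr_deriv (by ring)

lemma integrable_gaussianReal_iff {m : ℝ} {v : NNReal} (hv : v ≠ 0) {f : ℝ → ℝ} :
    Integrable f (gaussianReal m v) ↔ Integrable fun x => gaussianPDFReal m v x * f x := by
  rw [gaussianReal_of_var_ne_zero _ hv,
    integrable_withDensity_iff_integrable_smul' (measurable_gaussianPDF m v)
      (ae_of_all _ fun x => gaussianPDF_lt_top)]
  simp only [toReal_gaussianPDF, smul_eq_mul]

/-- Stein's identity. -/
lemma integral_sub_mul_gaussianReal {m : ℝ} {v : NNReal} (hv : v ≠ 0) {f f' : ℝ → ℝ}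
    (hderiv : ∀ x, HasDerivAt f (f' x) x) (hf : Integrable f (gaussianReal m v))
    (hf' : Integrable f' (gaussianReal m v))
    (hxf : Integrable (fun x => (x - m) * f x) (gaussianReal m v)) :
    ∫ x, (x - m) * f x ∂gaussianReal m v = v * ∫ x, f' x ∂gaussianReal m v := by
  have hv' : (v : ℝ) ≠ 0 := NNReal.coe_ne_zero.2 hv
  rw [integrable_gaussianReal_iff hv] at hf hf' hxf
  have parts := integral_mul_deriv_eq_deriv_mul_of_integrable (fun x _ => hderiv x)
    (fun x _ => hasDerivAt_gaussianPDFReal m hv x)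
    ((hxf.div_const (v : ℝ)).neg.congr (ae_of_all _ fun x => by
      simp only [Pi.neg_apply, Pi.mul_apply]; ring))
    (hf'.congr (ae_of_all _ fun x => by simp only [Pi.mul_apply]; ring))
    (hf.congr (ae_of_all _ fun x => by simp only [Pi.mul_apply]; ring))
  simp only [integral_gaussianReal_eq_integral_smul hv, smul_eq_mul]
  calc ∫ x, gaussianPDFReal m v x * ((x - m) * f x)
      = ∫ x, -v * (f x * -((x - m) / v * gaussianPDFReal m v x)) := by
        congr 1; ext x; field_simp
    _ = v * ∫ x, f' x * gaussianPDFReal m v x := by rw [integral_const_mul, parts]; ring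
    _ = _ := by simp only [mul_comm]

variable {ι : Type*} [Fintype ι]

/-- The law of independent standard Gaussian variables indexed by `ι`. -/
noncomputable abbrev stdGaussianPi (ι : Type*) [Fintype ι] : Measure (ι → ℝ) :=
  Measure.pi fun _ => gaussianReal 0 1

lemma memLp_two_id_gaussianReal (m : ℝ) (v : NNReal) : MemLp id 2 (gaussianReal m v) := by
  simpa using memLp_id_gaussianReal (μ := m) (v := v) 2

lemma integrable_eval_stdGaussianPi (i : ι) :
    Integrable (fun g : ι → ℝ => g i) (stdGaussianPi ι) :=
  ((memLp_two_id_gaussianReal 0 1).comp_measurePreserving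
    (measurePreserving_eval _ i)).integrable one_le_two

lemma integral_eval_mul_stdGaussianPi [DecidableEq ι] (i : ι) {f f' : (ι → ℝ) → ℝ}
    (hderiv : ∀ g t, HasDerivAt (fun s => f (Function.update g i s))
      (f' (Function.update g i t)) t)
    (hf : Integrable f (stdGaussianPi ι)) (hf' : Integrable f' (stdGaussianPi ι))
    (hgf : Integrable (fun g => g i * f g) (stdGaussianPi ι)) :
    ∫ g, g i * f g ∂stdGaussianPi ι = ∫ g, f' g ∂stdGaussianPi ι := by
  rw [← integral_averageCoord i hgf, ← integral_averageCoord i hf']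
  refine integral_congr_ae ?_
  filter_upwards [(integrable_comp_update i hf).prod_right_ae,
    (integrable_comp_update i hf').prod_right_ae,
    (integrable_comp_update i hgf).prod_right_ae] with g h1 h2 h3
  simp only [Function.update_self] at h3
  simpa [averageCoord] using
    integral_sub_mul_gaussianReal one_ne_zero (hderiv g) h1 h2 (by simpa using h3)

lemma L1Lipschitz.integral_abs_sub_integral_le {c : ℝ} {f : (ι → ℝ) → ℝ}
    (hf : L1Lipschitz c f) (hc : 0 ≤ c) :
    ∫ g, |f g - ∫ g', f g' ∂stdGaussianPi ι| ∂stdGaussianPi ι ≤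
      c * Real.sqrt (Fintype.card ι) := by
  have hμ (_ : ι) := memLp_two_id_gaussianReal 0 1
  refine (integral_abs_sub_integral_le_sqrt_variance (hf.memLp hμ)).trans ?_
  rw [← Real.sqrt_sq hc, ← Real.sqrt_mul (sq_nonneg c)]
  refine Real.sqrt_le_sqrt ((hf.variance_le hμ hc).trans_eq ?_)
  simp [variance_id_gaussianReal]

lemma measurePreserving_comp_of_injective {κ Ω : Type*} [Fintype κ] [MeasurableSpace Ω]
    (ν : Measure Ω) [IsProbabilityMeasure ν] {φ : κ → ι} (hφ : Function.Injective φ) :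
    MeasurePreserving (fun g : ι → Ω => g ∘ φ) (Measure.pi fun _ : ι => ν)
      (Measure.pi fun _ : κ => ν) := by
  have eval_pres (i : ι) := measurePreserving_eval (fun _ : ι => ν) i
  have hindep : iIndepFun (fun (k : κ) (g : ι → Ω) => g (φ k)) (Measure.pi fun _ : ι => ν) :=
    ((iIndepFun_iff_map_fun_eq_pi_map fun i => (eval_pres i).aemeasurable).2
      (by simp only [(eval_pres _).map_eq]; exact Measure.map_id)).precomp hφ
  refine ⟨by fun_prop, ?_⟩
  have := (iIndepFun_iff_map_fun_eq_pi_map fun k => (eval_pres (φ k)).aemeasurable).1 hindep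
  simp only [(eval_pres _).map_eq] at this
  exact this

end Gaussian

section ConvexAnalysis

lemma differentiableAt_of_continuousAt_rightDeriv {f : ℝ → ℝ} (hf : ConvexOn ℝ Set.univ f)
    {x : ℝ} (hx : ContinuousAt (fun y => derivWithin f (Set.Ioi y) y) x) :
    DifferentiableAt ℝ f x := by
  have mem_interior : x ∈ interior (Set.univ : Set ℝ) := by simp
  have right_deriv := hf.hasDerivWithinAt_rightDeriv_of_mem_interior mem_interior
  have left_deriv := hf.hasDerivWithinAt_leftDeriv_of_mem_interior mem_interior
  have right_le_left : derivWithin f (Set.Ioi x) x ≤ derivWithin f (Set.Iio x) x := by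
    refine le_of_tendsto (hx.tendsto.mono_left nhdsWithin_le_nhds : Tendsto _ (𝓝[<] x) _) ?_
    filter_upwards [self_mem_nhdsWithin] with y hy
    exact (hf.rightDeriv_le_slope_of_mem_interior (by simp) (Set.mem_univ x) hy).trans
      (hf.slope_le_leftDeriv_of_mem_interior (Set.mem_univ y) mem_interior hy)
  rw [le_antisymm (hf.leftDeriv_le_rightDeriv_of_mem_interior mem_interior) right_le_left]
    at left_deriv
  have two_sided := (hasDerivWithinAt_Iio_iff_Iic.1 left_deriv).union
    (hasDerivWithinAt_Ioi_iff_Ici.1 right_deriv)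
  rw [Set.Iic_union_Ici, hasDerivWithinAt_univ] at two_sided
  exact two_sided.differentiableAt

lemma countable_not_differentiableAt_of_convexOn {f : ℝ → ℝ} (hf : ConvexOn ℝ Set.univ f) :
    {x | ¬ DifferentiableAt ℝ f x}.Countable := by
  have monotone_rightDeriv : Monotone fun x => derivWithin f (Set.Ioi x) x := by
    simpa only [interior_univ, monotoneOn_univ] using hf.monotoneOn_rightDeriv
  exact monotone_rightDeriv.countable_not_continuousAt.mono fun x hx hcont =>
    hx (differentiableAt_of_continuousAt_rightDeriv hf hcont)

lemma mul_abs_sub_le_of_subgradient {φ p : ℝ → ℝ} {h s L δ η : ℝ}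
    (hs : ∀ t, t * s ≤ φ (h + t) - φ h) (hright : |p (h + δ) - p h - δ * L| ≤ η)
    (hleft : |p (h + -δ) - p h - -δ * L| ≤ η) :
    δ * |s - L| ≤
      |φ (h + δ) - p (h + δ)| + |φ (h + -δ) - p (h + -δ)| + |φ h - p h| + η := by
  have := hs δ
  have := hs (-δ)
  have := le_abs_self (φ (h + δ) - p (h + δ))
  have := le_abs_self (φ (h + -δ) - p (h + -δ))
  have := neg_abs_le (φ h - p h)
  have := abs_nonneg (φ (h + δ) - p (h + δ))
  have := abs_nonneg (φ (h + -δ) - p (h + -δ))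
  have := (abs_le.1 hright).2
  have := (abs_le.1 hleft).2
  rcases abs_cases (s - L) with ⟨habs, _⟩ | ⟨habs, _⟩ <;> rw [habs] <;> linarith

lemma mul_integral_abs_sub_le_of_subgradient {Ω : Type*} [MeasurableSpace Ω] {μ : Measure Ω}
    [IsProbabilityMeasure μ] {φ : ℝ → Ω → ℝ} {s : Ω → ℝ} {p : ℝ → ℝ} {h L δ η : ℝ}
    (hφ : ∀ t, Integrable (φ t) μ) (hs : Integrable s μ)
    (hsub : ∀ ω t, t * s ω ≤ φ (h + t) ω - φ h ω) (hright : |p (h + δ) - p h - δ * L| ≤ η)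
    (hleft : |p (h + -δ) - p h - -δ * L| ≤ η) :
    δ * ∫ ω, |s ω - L| ∂μ ≤
      ∫ ω, |φ (h + δ) ω - p (h + δ)| ∂μ + ∫ ω, |φ (h + -δ) ω - p (h + -δ)| ∂μ +
        ∫ ω, |φ h ω - p h| ∂μ + η := by
  have hdiff (t : ℝ) : Integrable (fun ω => |φ t ω - p t|) μ :=
    ((hφ t).sub (integrable_const _)).abs
  have hsum : Integrable
      (fun ω => |φ (h + δ) ω - p (h + δ)| + |φ (h + -δ) ω - p (h + -δ)|) μ :=
    (hdiff _).add (hdiff _)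
  have hsum' : Integrable
      (fun ω => |φ (h + δ) ω - p (h + δ)| + |φ (h + -δ) ω - p (h + -δ)| + |φ h ω - p h|) μ :=
    hsum.add (hdiff h)
  calc δ * ∫ ω, |s ω - L| ∂μ = ∫ ω, δ * |s ω - L| ∂μ := (integral_const_mul _ _).symm
    _ ≤ ∫ ω, (|φ (h + δ) ω - p (h + δ)| + |φ (h + -δ) ω - p (h + -δ)| + |φ h ω - p h| + η) ∂μ :=
        integral_mono ((hs.sub (integrable_const L)).abs.const_mul δ)
          (hsum'.add (integrable_const η))
          fun ω => mul_abs_sub_le_of_subgradient (φ := fun t => φ t ω) (hsub ω) hright hleft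
    _ = _ := by
        rw [integral_add hsum' (integrable_const η), integral_add hsum (hdiff h),
          integral_add (hdiff _) (hdiff _), integral_const, probReal_univ, one_smul]

lemma tendsto_integral_abs_sub_of_subgradient {ι : Type*} {l : Filter ι} {Ω : ι → Type*}
    [∀ i, MeasurableSpace (Ω i)] {μ : ∀ i, Measure (Ω i)} [∀ i, IsProbabilityMeasure (μ i)]
    {φ : ∀ i, ℝ → Ω i → ℝ} {s : ∀ i, Ω i → ℝ} {p : ℝ → ℝ} {h L : ℝ}
    (hφ : ∀ i t, Integrable (φ i t) (μ i)) (hs : ∀ i, Integrable (s i) (μ i))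
    (hsub : ∀ i ω t, t * s i ω ≤ φ i (h + t) ω - φ i h ω)
    (hlim : ∀ t, Tendsto (fun i => ∫ ω, |φ i t ω - p t| ∂μ i) l (𝓝 0))
    (hp : HasDerivAt p L h) :
    Tendsto (fun i => ∫ ω, |s i ω - L| ∂μ i) l (𝓝 0) := by
  refine Metric.tendsto_nhds.2 fun ε hε => ?_
  have linearization : ∀ᶠ t in 𝓝 (0 : ℝ), |p (h + t) - p h - t * L| ≤ ε / 2 * |t| := by
    simpa using (hasDerivAt_iff_isLittleO_nhds_zero.1 hp).def (half_pos hε)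
  obtain ⟨r, hr, hball⟩ := Metric.eventually_nhds_iff.1 linearization
  obtain ⟨δ, hδ, hδr⟩ := exists_between hr
  have hright := hball (y := δ) (by rwa [dist_zero_right, Real.norm_eq_abs, abs_of_pos hδ])
  have hleft := hball (y := -δ) (by
    rwa [dist_zero_right, Real.norm_eq_abs, abs_neg, abs_of_pos hδ])
  rw [abs_neg, abs_of_pos hδ] at hleft
  rw [abs_of_pos hδ] at hright
  have errors := ((hlim (h + δ)).add (hlim (h + -δ))).add (hlim h)
  rw [add_zero, add_zero] at errors
  filter_upwards [errors.eventually_lt_const (by positivity : 0 < δ * (ε / 2))] with i hi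
  have := mul_integral_abs_sub_le_of_subgradient (hφ i) (hs i) (hsub i) hright hleft
  rw [Real.dist_0_eq_abs, abs_of_nonneg (integral_nonneg fun ω => abs_nonneg _)]
  exact lt_of_mul_lt_mul_left (by linarith) hδ.le

end ConvexAnalysis

section ReplicaMean

variable {ι : Type*} [Fintype ι]

/-- The mean over two independent replicas drawn from the Gibbs measure with exponent `a`: their
joint law is the Gibbs measure whose exponent is the sum of the two exponents. -/
noncomputable def replicaMean (a : ι → ℝ) : (ι × ι → ℝ) →ₗ[ℝ] ℝ :=
  gibbsMean fun p => a p.1 + a p.2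

lemma replicaMean_mul (a f g : ι → ℝ) :
    replicaMean a (fun p => f p.1 * g p.2) = gibbsMean a f * gibbsMean a g := by
  simp only [replicaMean, gibbsMean_apply, Real.exp_add, Fintype.sum_prod_type, div_mul_div_comm,
    Finset.sum_mul_sum]
  congr 1
  exact Finset.sum_congr rfl fun _ _ => Finset.sum_congr rfl fun _ _ => by ring

end ReplicaMean

section SpinSystem

variable {V : Type*}

/-- The value in `{-1, 1} ⊆ ℝ` of the spin at `x`, as an observable; `ℤˣ = {1, -1}`. -/
def spin (x : V) (σ : V → ℤˣ) : ℝ := ((σ x : ℤ) : ℝ)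

lemma abs_spin (x : V) (σ : V → ℤˣ) : |spin x σ| = 1 := by
  rcases Int.units_eq_one_or (σ x) with h | h <;> simp [spin, h]

lemma spin_mul_self (x : V) : spin x * spin x = fun _ => 1 := by
  ext σ
  rw [Pi.mul_apply, ← abs_mul_abs_self, abs_spin, one_mul]

lemma monotone_spin (x : V) : Monotone (spin x) :=
  fun _ _ hστ => Int.cast_le.2 (Units.val_le_val.2 (hστ x))

lemma spin_inf_add_spin_sup (x : V) (σ τ : V → ℤˣ) :
    spin x (σ ⊓ τ) + spin x (σ ⊔ τ) = spin x σ + spin x τ := by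
  have units_identity : ∀ a b : ℤˣ, ((a ⊓ b : ℤˣ) : ℤ) + ((a ⊔ b : ℤˣ) : ℤ) = a + b := by decide
  simp only [spin, Pi.inf_apply, Pi.sup_apply]
  exact_mod_cast units_identity (σ x) (τ x)

variable [Fintype V]

lemma abs_sum_div_card_le {f : V → ℝ} {C : ℝ} (hC : 0 ≤ C) (hf : ∀ x, |f x| ≤ C) :
    |(∑ x, f x) / Fintype.card V| ≤ C := by
  rw [abs_div, Nat.abs_cast]
  refine div_le_of_le_mul₀ (Nat.cast_nonneg _) hC ((Finset.abs_sum_le_sum_abs _ _).trans ?_)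
  refine (Finset.sum_le_sum fun x _ => hf x).trans_eq ?_
  rw [Finset.sum_const, Finset.card_univ, nsmul_eq_mul, mul_comm]

/-- The overlap `|V|⁻¹ ∑ x, σ_x τ_x` of two configurations. -/
noncomputable def overlap (p : (V → ℤˣ) × (V → ℤˣ)) : ℝ :=
  (∑ x, spin x p.1 * spin x p.2) / Fintype.card V

lemma abs_overlap_le_one (p : (V → ℤˣ) × (V → ℤˣ)) : |overlap p| ≤ 1 :=
  abs_sum_div_card_le zero_le_one fun x => by rw [abs_mul, abs_spin, abs_spin, one_mul]

section Energy

/-- The exponent `H(σ) + h ∑ x, g x σ x` of the Gibbs measure of a spin system with interaction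
`H` in the external field `g` of strength `h`. -/
def energy (H : (V → ℤˣ) → ℝ) (h : ℝ) (g : V → ℝ) (σ : V → ℤˣ) : ℝ :=
  H σ + h * ∑ x, g x * spin x σ

variable (H : (V → ℤˣ) → ℝ) (h : ℝ) (g : V → ℝ)

lemma continuous_energy : Continuous (energy H h) :=
  continuous_pi fun σ => by unfold energy; fun_prop

lemma hasDerivAt_energy_update [DecidableEq V] (x : V) (t : ℝ) :
    HasDerivAt (fun s => energy H h (Function.update g x s)) (h • spin x) t := by
  refine hasDerivAt_pi.2 fun σ => ?_
  have field_deriv := HasDerivAt.fun_sum fun y (_ : y ∈ Finset.univ) =>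
    (hasDerivAt_pi.1 (hasDerivAt_update g x t) y).mul_const (spin y σ)
  refine ((field_deriv.const_mul h).const_add (H σ)).congr_deriv ?_
  simp [Pi.single_apply]

lemma supermodular_energy {H : (V → ℤˣ) → ℝ} (hH : Supermodular H) :
    Supermodular (energy H h g) := by
  intro σ τ
  have modular_field : ∑ x, g x * spin x (σ ⊓ τ) + ∑ x, g x * spin x (σ ⊔ τ) =
      ∑ x, g x * spin x σ + ∑ x, g x * spin x τ := by
    simp only [← Finset.sum_add_distrib, ← mul_add, spin_inf_add_spin_sup]
  have := congrArg (h * ·) modular_field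
  simp only [mul_add] at this
  simp only [energy]
  linarith [hH σ τ]

end Energy

variable [DecidableEq V] (H : (V → ℤˣ) → ℝ) (h : ℝ) (g : V → ℝ)

/-- The free energy per site in the field `g`. -/
noncomputable def freeEnergy : ℝ := logSumExp (energy H h g) / Fintype.card V

/-- The local magnetization `⟨σ_x⟩`. -/
noncomputable def magnetization (x : V) : ℝ := gibbsMean (energy H h g) (spin x)

/-- The truncated correlation `⟨σ_x σ_y⟩ - ⟨σ_x⟩⟨σ_y⟩`. -/
noncomputable def truncatedCorrelation (x y : V) : ℝ :=
  gibbsCov (energy H h g) (spin x) (spin y)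

/-- The Gibbs mean of the field energy `|V|⁻¹ ∑ x, g x σ_x` per site; it is the derivative of the
free energy in the field strength. -/
noncomputable def fieldEnergy : ℝ := (∑ x, g x * magnetization H h g x) / Fintype.card V

/-- The mean overlap of two independent replicas. -/
noncomputable def meanOverlap : ℝ := (∑ x, magnetization H h g x ^ 2) / Fintype.card V

/-- The mean square deviation from `q` of the overlap of two independent replicas. -/
noncomputable def overlapSquareDeviation (q : ℝ) : ℝ :=
  replicaMean (energy H h g) fun p => (overlap p - q) ^ 2

/-- The susceptibility: the total truncated correlation per site. -/
noncomputable def susceptibility : ℝ :=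
  (∑ x, ∑ y, truncatedCorrelation H h g x y) / Fintype.card V

lemma abs_magnetization_le_one (x : V) : |magnetization H h g x| ≤ 1 :=
  abs_gibbsMean_le _ fun σ => (abs_spin x σ).le

lemma continuous_magnetization (x : V) : Continuous fun g => magnetization H h g x :=
  (continuous_gibbsMean _).comp (continuous_energy H h)

lemma hasDerivAt_magnetization_update (x y : V) (t : ℝ) :
    HasDerivAt (fun s => magnetization H h (Function.update g y s) x)
      (h * truncatedCorrelation H h (Function.update g y t) x y) t := by
  refine (hasDerivAt_gibbsMean (hasDerivAt_energy_update H h g y t) (spin x)).congr_deriv ?_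
  simp only [truncatedCorrelation, gibbsCov, mul_smul_comm, map_smul, smul_eq_mul]
  ring

lemma continuous_truncatedCorrelation (x y : V) :
    Continuous fun g => truncatedCorrelation H h g x y :=
  ((continuous_gibbsMean _).comp (continuous_energy H h)).sub
    ((continuous_magnetization H h x).mul (continuous_magnetization H h y))

lemma abs_truncatedCorrelation_le_two (x y : V) : |truncatedCorrelation H h g x y| ≤ 2 := by
  refine (abs_gibbsCov_le (energy H h g) (fun σ => (abs_spin x σ).le)
    fun σ => (abs_spin y σ).le).trans_eq ?_
  norm_num

lemma truncatedCorrelation_self (x : V) :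
    truncatedCorrelation H h g x x = 1 - magnetization H h g x ^ 2 := by
  rw [truncatedCorrelation, gibbsCov, spin_mul_self, gibbsMean_const, magnetization, sq]

lemma truncatedCorrelation_nonneg {H : (V → ℤˣ) → ℝ} (hH : Supermodular H) (x y : V) :
    0 ≤ truncatedCorrelation H h g x y :=
  gibbsCov_nonneg (supermodular_energy h g hH) (monotone_spin x) (monotone_spin y)

lemma sum_truncatedCorrelation_self_div_card [Nonempty V] :
    (∑ x, truncatedCorrelation H h g x x) / Fintype.card V = 1 - meanOverlap H h g := by
  simp only [truncatedCorrelation_self, Finset.sum_sub_distrib, Finset.sum_const,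
    Finset.card_univ, nsmul_eq_mul, mul_one, sub_div, meanOverlap]
  rw [div_self (Nat.cast_ne_zero.2 Fintype.card_ne_zero)]

lemma mul_fieldEnergy_le_freeEnergy_sub (t : ℝ) :
    t * fieldEnergy H h g ≤ freeEnergy H (h + t) g - freeEnergy H h g := by
  have increment : energy H (h + t) g - energy H h g = t • ∑ x, g x • spin x := by
    ext σ
    simp only [Pi.sub_apply, energy, Pi.smul_apply, Finset.sum_apply, smul_eq_mul]
    ring
  have tangent := gibbsMean_sub_le_logSumExp_sub (energy H h g) (energy H (h + t) g)
  simp only [increment, map_smul, map_sum, smul_eq_mul] at tangent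
  rw [fieldEnergy, freeEnergy, freeEnergy, ← sub_div, ← mul_div_assoc]
  gcongr
  exact tangent

lemma l1Lipschitz_freeEnergy :
    L1Lipschitz (|h| / Fintype.card V) (freeEnergy H h) := by
  intro g g'
  rw [freeEnergy, freeEnergy, ← sub_div, abs_div, Nat.abs_cast, div_mul_eq_mul_div]
  gcongr
  refine abs_logSumExp_sub_le fun σ => ?_
  have difference : energy H h g σ - energy H h g' σ = h * ∑ x, (g x - g' x) * spin x σ := by
    simp only [energy, sub_mul, Finset.sum_sub_distrib]
    ring
  rw [difference, abs_mul]
  gcongr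
  refine (Finset.abs_sum_le_sum_abs _ _).trans_eq ?_
  simp only [abs_mul, abs_spin, mul_one]

lemma abs_meanOverlap_le_one : |meanOverlap H h g| ≤ 1 :=
  abs_sum_div_card_le zero_le_one fun x => by
    rw [abs_pow]
    exact pow_le_one₀ (abs_nonneg _) (abs_magnetization_le_one H h g x)

lemma continuous_meanOverlap : Continuous (meanOverlap H h) :=
  (continuous_finsetSum _ fun x _ => (continuous_magnetization H h x).pow 2).div_const _

lemma overlapSquareDeviation_nonneg (q : ℝ) : 0 ≤ overlapSquareDeviation H h g q :=
  (map_zero (replicaMean (energy H h g))).ge.trans (gibbsMean_mono _ fun _ => sq_nonneg _)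

lemma sq_abs_sub_one_le_overlapSquareDeviation {q : ℝ} (hq : 1 ≤ |q|) :
    (|q| - 1) ^ 2 ≤ overlapSquareDeviation H h g q := by
  refine (gibbsMean_const _ _).ge.trans (gibbsMean_mono _ fun p => sq_le_sq.2 ?_)
  rw [abs_of_nonneg (sub_nonneg.2 hq), abs_sub_comm]
  linarith [abs_overlap_le_one p, abs_sub_abs_le_abs_sub q (overlap p)]

lemma continuous_overlapSquareDeviation (q : ℝ) :
    Continuous fun g => overlapSquareDeviation H h g q := by
  have := continuous_energy H h
  exact (continuous_gibbsMean _).comp (by fun_prop)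

lemma replicaMean_overlap : replicaMean (energy H h g) overlap = meanOverlap H h g := by
  have expand : (overlap : (V → ℤˣ) × (V → ℤˣ) → ℝ) =
      (Fintype.card V : ℝ)⁻¹ • ∑ x, fun p => spin x p.1 * spin x p.2 := by
    ext p
    simp only [overlap, Pi.smul_apply, Finset.sum_apply, smul_eq_mul, div_eq_inv_mul]
  simp only [expand, map_smul, map_sum, replicaMean_mul, smul_eq_mul, meanOverlap,
    magnetization, sq, div_eq_inv_mul]

lemma replicaMean_overlap_sq :
    replicaMean (energy H h g) (overlap ^ 2) =
      (∑ x, ∑ y, gibbsMean (energy H h g) (spin x * spin y) ^ 2) / (Fintype.card V : ℝ) ^ 2 := by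
  have expand : (overlap ^ 2 : (V → ℤˣ) × (V → ℤˣ) → ℝ) = ((Fintype.card V : ℝ) ^ 2)⁻¹ •
      ∑ x : V, ∑ y : V, fun p => (spin x * spin y) p.1 * (spin x * spin y) p.2 := by
    ext p
    simp only [overlap, Pi.pow_apply, Pi.smul_apply, Finset.sum_apply, smul_eq_mul, Pi.mul_apply]
    rw [div_pow, div_eq_inv_mul, sq (∑ x, _), Finset.sum_mul_sum]
    congr 1
    exact Finset.sum_congr rfl fun _ _ => Finset.sum_congr rfl fun _ _ => by ring
  simp only [expand, map_smul, map_sum, replicaMean_mul, smul_eq_mul, ← sq, div_eq_inv_mul]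

lemma replicaMean_overlap_sq_sub_le {H : (V → ℤˣ) → ℝ} (hH : Supermodular H) :
    replicaMean (energy H h g) (overlap ^ 2) - meanOverlap H h g ^ 2 ≤
      2 * susceptibility H h g / Fintype.card V := by
  set a := energy H h g
  have term_le (x y : V) : gibbsMean a (spin x * spin y) ^ 2 -
      magnetization H h g x ^ 2 * magnetization H h g y ^ 2 ≤
        2 * truncatedCorrelation H h g x y := by
    have hT := truncatedCorrelation_nonneg h g hH x y
    have hxy : |gibbsMean a (spin x * spin y)| ≤ 1 := abs_gibbsMean_le a fun σ => by
      rw [Pi.mul_apply, abs_mul, abs_spin, abs_spin, one_mul]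
    have hmm : |magnetization H h g x * magnetization H h g y| ≤ 1 := by
      rw [abs_mul]
      exact mul_le_one₀ (abs_magnetization_le_one H h g x) (abs_nonneg _)
        (abs_magnetization_le_one H h g y)
    calc _ = truncatedCorrelation H h g x y *
          (gibbsMean a (spin x * spin y) + magnetization H h g x * magnetization H h g y) := by
          simp only [truncatedCorrelation, gibbsCov, magnetization, a]
          ring
      _ ≤ truncatedCorrelation H h g x y * 2 := mul_le_mul_of_nonneg_left
          (by linarith [(abs_le.1 hxy).2, (abs_le.1 hmm).2]) hT
      _ = _ := mul_comm _ _
  have hsum := Finset.sum_le_sum fun x (_ : x ∈ Finset.univ) =>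
    Finset.sum_le_sum fun y (_ : y ∈ Finset.univ) => term_le x y
  simp only [Finset.sum_sub_distrib, ← Finset.mul_sum _ _ (2 : ℝ)] at hsum
  rw [replicaMean_overlap_sq, meanOverlap, div_pow, ← sub_div, susceptibility, ← mul_div_assoc,
    div_div, ← sq]
  gcongr
  rwa [sq (∑ x, _), Finset.sum_mul_sum]

lemma overlapSquareDeviation_le {H : (V → ℤˣ) → ℝ} (hH : Supermodular H) (q : ℝ) :
    overlapSquareDeviation H h g q ≤
      (meanOverlap H h g - q) ^ 2 + 2 * susceptibility H h g / Fintype.card V := by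
  have expand : (fun p : (V → ℤˣ) × (V → ℤˣ) => (overlap p - q) ^ 2) =
      overlap ^ 2 - (2 * q) • overlap + fun _ => q ^ 2 := by
    ext p
    simp only [Pi.add_apply, Pi.sub_apply, Pi.pow_apply, Pi.smul_apply, smul_eq_mul]
    ring
  have mean_const : replicaMean (energy H h g) (fun _ => q ^ 2) = q ^ 2 := gibbsMean_const _ _
  rw [overlapSquareDeviation, expand, map_add, map_sub, map_smul, smul_eq_mul,
    replicaMean_overlap, mean_const]
  linarith [replicaMean_overlap_sq_sub_le h g hH]

end SpinSystem

section BoundedObservables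

variable {V : Type*} [Fintype V] {f f' : (V → ℝ) → ℝ} {C C' : ℝ}

lemma integrable_stdGaussianPi_of_abs_le (hf : Continuous f) (hC : ∀ g, |f g| ≤ C) :
    Integrable f (stdGaussianPi V) :=
  .of_bound hf.aestronglyMeasurable C (ae_of_all _ hC)

lemma integrable_eval_mul_stdGaussianPi (x : V) (hf : Continuous f) (hC : ∀ g, |f g| ≤ C) :
    Integrable (fun g => g x * f g) (stdGaussianPi V) :=
  (integrable_eval_stdGaussianPi x).mul_bdd hf.aestronglyMeasurable (ae_of_all _ hC)

lemma integral_eval_mul_stdGaussianPi_of_abs_le [DecidableEq V] (x : V)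
    (hderiv : ∀ g t, HasDerivAt (fun s => f (Function.update g x s))
      (f' (Function.update g x t)) t)
    (hf : Continuous f) (hC : ∀ g, |f g| ≤ C) (hf' : Continuous f') (hC' : ∀ g, |f' g| ≤ C') :
    ∫ g, g x * f g ∂stdGaussianPi V = ∫ g, f' g ∂stdGaussianPi V :=
  integral_eval_mul_stdGaussianPi x hderiv (integrable_stdGaussianPi_of_abs_le hf hC)
    (integrable_stdGaussianPi_of_abs_le hf' hC') (integrable_eval_mul_stdGaussianPi x hf hC)

lemma integral_abs_sum_eval_le :
    ∫ g, |∑ x, g x| ∂stdGaussianPi V ≤ Real.sqrt (Fintype.card V) := by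
  have lipschitz : L1Lipschitz 1 fun g : V → ℝ => ∑ x, g x := fun g g' => by
    rw [one_mul, ← Finset.sum_sub_distrib]
    exact Finset.abs_sum_le_sum_abs _ _
  have mean_zero : ∫ g, ∑ x, g x ∂stdGaussianPi V = 0 := by
    rw [integral_finsetSum _ fun x _ => integrable_eval_stdGaussianPi x]
    refine Finset.sum_eq_zero fun x _ => ?_
    exact (integral_comp_eval (μ := fun _ : V => gaussianReal 0 1) (f := id)
      aestronglyMeasurable_id).trans integral_id_gaussianReal
  simpa only [mean_zero, sub_zero, one_mul] using
    lipschitz.integral_abs_sub_integral_le zero_le_one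

/-- By Gaussian integration by parts the left-hand side is the correlation of `f` with
`∑ x, g x`, which is of order `√|V|`. -/
lemma sum_integral_deriv_le [DecidableEq V] {f' : V → (V → ℝ) → ℝ}
    (hderiv : ∀ x g t, HasDerivAt (fun s => f (Function.update g x s))
      (f' x (Function.update g x t)) t)
    (hf : Continuous f) (hC : ∀ g, |f g| ≤ C) (hf' : ∀ x, Continuous (f' x))
    (hC' : ∀ x g, |f' x g| ≤ C') :
    ∑ x, ∫ g, f' x g ∂stdGaussianPi V ≤ C * Real.sqrt (Fintype.card V) := by
  have integrable_abs_sum : Integrable (fun g : V → ℝ => |∑ x, g x|) (stdGaussianPi V) :=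
    (integrable_finsetSum _ fun x _ => integrable_eval_stdGaussianPi x).abs
  calc ∑ x, ∫ g, f' x g ∂stdGaussianPi V
      = ∑ x, ∫ g, g x * f g ∂stdGaussianPi V := Finset.sum_congr rfl fun x _ =>
        (integral_eval_mul_stdGaussianPi_of_abs_le x (hderiv x) hf hC (hf' x) (hC' x)).symm
    _ = ∫ g, (∑ x, g x) * f g ∂stdGaussianPi V := by
        rw [← integral_finsetSum _ fun x _ => integrable_eval_mul_stdGaussianPi x hf hC]
        simp only [Finset.sum_mul]
    _ ≤ ∫ g, |(∑ x, g x) * f g| ∂stdGaussianPi V :=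
        (le_abs_self _).trans abs_integral_le_integral_abs
    _ ≤ ∫ g, C * |∑ x, g x| ∂stdGaussianPi V := by
        refine integral_mono_of_nonneg (ae_of_all _ fun g => abs_nonneg _)
          (integrable_abs_sum.const_mul C) (ae_of_all _ fun g => ?_)
        simp only [abs_mul, mul_comm C]
        gcongr
        exact hC g
    _ ≤ C * Real.sqrt (Fintype.card V) := by
        rw [integral_const_mul]
        exact mul_le_mul_of_nonneg_left integral_abs_sum_eval_le ((abs_nonneg _).trans (hC 0))

end BoundedObservables

section IntegrationByParts

variable {V : Type*} [Fintype V] [DecidableEq V] (H : (V → ℤˣ) → ℝ) (h : ℝ)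

lemma integrable_truncatedCorrelation (x y : V) :
    Integrable (fun g => truncatedCorrelation H h g x y) (stdGaussianPi V) :=
  integrable_stdGaussianPi_of_abs_le (continuous_truncatedCorrelation H h x y)
    fun g => abs_truncatedCorrelation_le_two H h g x y

lemma integrable_susceptibility : Integrable (susceptibility H h) (stdGaussianPi V) :=
  (integrable_finsetSum _ fun x _ => integrable_finsetSum _ fun y _ =>
    integrable_truncatedCorrelation H h x y).div_const _

lemma integrable_fieldEnergy : Integrable (fieldEnergy H h) (stdGaussianPi V) :=
  (integrable_finsetSum _ fun x _ => integrable_eval_mul_stdGaussianPi x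
    (continuous_magnetization H h x) fun g => abs_magnetization_le_one H h g x).div_const _

lemma integrable_freeEnergy : Integrable (freeEnergy H h) (stdGaussianPi V) :=
  ((l1Lipschitz_freeEnergy H h).memLp fun _ => memLp_two_id_gaussianReal 0 1).integrable
    one_le_two

lemma mul_integral_susceptibility_le :
    h * ∫ g, susceptibility H h g ∂stdGaussianPi V ≤ Real.sqrt (Fintype.card V) := by
  set m' : V → (V → ℝ) → ℝ := fun y g =>
    (∑ x, h * truncatedCorrelation H h g x y) / Fintype.card V
  have abs_m'_le (y : V) (g : V → ℝ) : |m' y g| ≤ |h| * 2 :=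
    abs_sum_div_card_le (by positivity) fun x => by
      rw [abs_mul]
      gcongr
      exact abs_truncatedCorrelation_le_two H h g x y
  have continuous_m' (y : V) : Continuous (m' y) := (continuous_finsetSum _ fun x _ =>
    (continuous_truncatedCorrelation H h x y).const_mul h).div_const _
  have susceptibility_eq (g : V → ℝ) : h * susceptibility H h g = ∑ y, m' y g := by
    simp only [susceptibility, m', ← Finset.sum_div, ← Finset.mul_sum]
    rw [Finset.sum_comm, mul_div_assoc]
  rw [← integral_const_mul]
  simp only [susceptibility_eq]
  rw [integral_finsetSum _ fun y _ =>
    integrable_stdGaussianPi_of_abs_le (continuous_m' y) (abs_m'_le y), ← one_mul (Real.sqrt _)]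
  exact sum_integral_deriv_le
    (fun y g t => (HasDerivAt.fun_sum fun x _ =>
      hasDerivAt_magnetization_update H h g x y t).div_const _)
    ((continuous_finsetSum _ fun x _ => continuous_magnetization H h x).div_const _)
    (fun g => abs_sum_div_card_le zero_le_one (abs_magnetization_le_one H h g))
    continuous_m' abs_m'_le

section FieldEnergy

variable {H h} {φ φ' : (V → ℝ) → ℝ} {C C' : ℝ}

lemma abs_magnetization_mul_le (x : V) (hC : ∀ g, |φ g| ≤ C) (g : V → ℝ) :
    |magnetization H h g x * φ g| ≤ C := by
  rw [abs_mul]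
  exact (mul_le_of_le_one_left (abs_nonneg _) (abs_magnetization_le_one H h g x)).trans (hC g)

lemma integrable_eval_mul_magnetization_mul (x : V) (hφ : Continuous φ) (hC : ∀ g, |φ g| ≤ C) :
    Integrable (fun g => g x * (magnetization H h g x * φ g)) (stdGaussianPi V) :=
  integrable_eval_mul_stdGaussianPi x ((continuous_magnetization H h x).mul hφ)
    (abs_magnetization_mul_le x hC)

lemma integrable_deriv_magnetization_mul (x : V) (hφ : Continuous φ) (hC : ∀ g, |φ g| ≤ C)
    (hφ' : Continuous φ') (hC' : ∀ g, |φ' g| ≤ C') :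
    Integrable (fun g => h * truncatedCorrelation H h g x x * φ g + magnetization H h g x * φ' g)
      (stdGaussianPi V) :=
  (((integrable_truncatedCorrelation H h x x).const_mul h).mul_bdd
    hφ.aestronglyMeasurable (ae_of_all _ hC)).add
    (integrable_stdGaussianPi_of_abs_le ((continuous_magnetization H h x).mul hφ')
      (abs_magnetization_mul_le x hC'))

lemma integral_eval_mul_magnetization_mul (x : V)
    (hderiv : ∀ g t, HasDerivAt (fun s => φ (Function.update g x s))
      (φ' (Function.update g x t)) t)
    (hφ : Continuous φ) (hC : ∀ g, |φ g| ≤ C) (hφ' : Continuous φ') (hC' : ∀ g, |φ' g| ≤ C') :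
    ∫ g, g x * (magnetization H h g x * φ g) ∂stdGaussianPi V =
      ∫ g, (h * truncatedCorrelation H h g x x * φ g + magnetization H h g x * φ' g)
        ∂stdGaussianPi V :=
  integral_eval_mul_stdGaussianPi x
    (fun g t => (hasDerivAt_magnetization_update H h g x x t).fun_mul (hderiv g t))
    (integrable_stdGaussianPi_of_abs_le ((continuous_magnetization H h x).mul hφ)
      (abs_magnetization_mul_le x hC))
    (integrable_deriv_magnetization_mul x hφ hC hφ' hC')
    (integrable_eval_mul_magnetization_mul x hφ hC)

lemma integral_fieldEnergy_mul [Nonempty V] {φ' : V → (V → ℝ) → ℝ}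
    (hderiv : ∀ x g t, HasDerivAt (fun s => φ (Function.update g x s))
      (φ' x (Function.update g x t)) t)
    (hφ : Continuous φ) (hC : ∀ g, |φ g| ≤ C) (hφ' : ∀ x, Continuous (φ' x))
    (hC' : ∀ x g, |φ' x g| ≤ C') :
    ∫ g, fieldEnergy H h g * φ g ∂stdGaussianPi V =
      ∫ g, (h * (1 - meanOverlap H h g) * φ g +
        (∑ x, magnetization H h g x * φ' x g) / Fintype.card V) ∂stdGaussianPi V := by
  calc ∫ g, fieldEnergy H h g * φ g ∂stdGaussianPi V
      = (∑ x, ∫ g, g x * (magnetization H h g x * φ g) ∂stdGaussianPi V) / Fintype.card V := by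
        rw [← integral_finsetSum _ fun x _ => integrable_eval_mul_magnetization_mul x hφ hC,
          ← integral_div]
        simp only [fieldEnergy, div_mul_eq_mul_div, Finset.sum_mul, mul_assoc]
    _ = ∫ g, (∑ x, (h * truncatedCorrelation H h g x x * φ g + magnetization H h g x * φ' x g)) /
          Fintype.card V ∂stdGaussianPi V := by
        rw [integral_div, integral_finsetSum _ fun x _ =>
          integrable_deriv_magnetization_mul x hφ hC (hφ' x) (hC' x)]
        exact congrArg (· / _) (Finset.sum_congr rfl fun x _ =>
          integral_eval_mul_magnetization_mul x (hderiv x) hφ hC (hφ' x) (hC' x))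
    _ = _ := by
        refine integral_congr_ae (ae_of_all _ fun g => ?_)
        simp only [Finset.sum_add_distrib, add_div, ← Finset.sum_mul, ← Finset.mul_sum]
        rw [← sum_truncatedCorrelation_self_div_card H h g]
        ring

end FieldEnergy

/-- The partial derivative at `x` of the mean overlap with respect to the field. -/
noncomputable def overlapGradient (x : V) (g : V → ℝ) : ℝ :=
  (∑ y, 2 * h * (magnetization H h g y * truncatedCorrelation H h g y x)) / Fintype.card V

lemma hasDerivAt_meanOverlap_update (x : V) (g : V → ℝ) (t : ℝ) :
    HasDerivAt (fun s => meanOverlap H h (Function.update g x s))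
      (overlapGradient H h x (Function.update g x t)) t := by
  refine ((HasDerivAt.fun_sum fun y (_ : y ∈ Finset.univ) =>
    (hasDerivAt_magnetization_update H h g y x t).fun_pow 2).div_const _).congr_deriv ?_
  rw [overlapGradient]
  congr 1
  exact Finset.sum_congr rfl fun y _ => by push_cast; ring

lemma continuous_overlapGradient (x : V) : Continuous (overlapGradient H h x) :=
  (continuous_finsetSum _ fun y _ => ((continuous_magnetization H h y).mul
    (continuous_truncatedCorrelation H h y x)).const_mul _).div_const _

lemma abs_overlapGradient_le (x : V) (g : V → ℝ) : |overlapGradient H h x g| ≤ |2 * h| * 2 :=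
  abs_sum_div_card_le (by positivity) fun y => by
    rw [abs_mul]
    gcongr
    exact abs_magnetization_mul_le y (abs_truncatedCorrelation_le_two H h · y x) g

lemma abs_meanOverlap_sub_le (g : V → ℝ) (q : ℝ) : |meanOverlap H h g - q| ≤ 1 + |q| :=
  (abs_sub _ _).trans (add_le_add_left (abs_meanOverlap_le_one H h g) _)

lemma integrable_meanOverlap : Integrable (meanOverlap H h) (stdGaussianPi V) :=
  integrable_stdGaussianPi_of_abs_le (continuous_meanOverlap H h) (abs_meanOverlap_le_one H h)

lemma integrable_overlapSquareDeviation (q : ℝ) :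
    Integrable (fun g => overlapSquareDeviation H h g q) (stdGaussianPi V) := by
  refine integrable_stdGaussianPi_of_abs_le (C := (1 + |q|) ^ 2)
    (continuous_overlapSquareDeviation H h q) fun g => abs_gibbsMean_le _ fun p => ?_
  rw [abs_pow]
  gcongr
  exact (abs_sub _ _).trans (add_le_add_left (abs_overlap_le_one p) _)

lemma integrable_magnetization_mul_overlapGradient :
    Integrable (fun g => (∑ x, magnetization H h g x * overlapGradient H h x g) / Fintype.card V)
      (stdGaussianPi V) :=
  (integrable_finsetSum _ fun x _ => integrable_stdGaussianPi_of_abs_le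
    ((continuous_magnetization H h x).mul (continuous_overlapGradient H h x))
    (abs_magnetization_mul_le x (abs_overlapGradient_le H h x))).div_const _

lemma integral_fieldEnergy_mul_meanOverlap_sub [Nonempty V] (q : ℝ) :
    ∫ g, fieldEnergy H h g * (meanOverlap H h g - q) ∂stdGaussianPi V =
      ∫ g, (h * (1 - meanOverlap H h g) * (meanOverlap H h g - q) +
        (∑ x, magnetization H h g x * overlapGradient H h x g) / Fintype.card V)
          ∂stdGaussianPi V :=
  integral_fieldEnergy_mul
    (fun x g t => (hasDerivAt_meanOverlap_update H h x g t).sub_const q)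
    ((continuous_meanOverlap H h).sub continuous_const) (abs_meanOverlap_sub_le H h · q)
    (continuous_overlapGradient H h) (abs_overlapGradient_le H h)

variable {H h}

lemma sum_magnetization_mul_overlapGradient_le (hH : Supermodular H) (hh : 0 ≤ h) (g : V → ℝ) :
    (∑ x, magnetization H h g x * overlapGradient H h x g) / Fintype.card V ≤
      2 * (h * susceptibility H h g) / Fintype.card V := by
  have term_le (x y : V) : magnetization H h g x *
      (2 * h * (magnetization H h g y * truncatedCorrelation H h g y x)) ≤
        2 * h * truncatedCorrelation H h g y x := by
    have hmm : magnetization H h g x * magnetization H h g y ≤ 1 :=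
      (le_abs_self _).trans (abs_mul (magnetization H h g x) _ ▸
        mul_le_one₀ (abs_magnetization_le_one H h g x) (abs_nonneg _)
          (abs_magnetization_le_one H h g y))
    have hT := truncatedCorrelation_nonneg h g hH y x
    calc _ = magnetization H h g x * magnetization H h g y *
          (2 * h * truncatedCorrelation H h g y x) := by ring
      _ ≤ _ := mul_le_of_le_one_left (by positivity) hmm
  gcongr
  calc ∑ x, magnetization H h g x * overlapGradient H h x g
      ≤ ∑ x, (∑ y, 2 * h * truncatedCorrelation H h g y x) / Fintype.card V := by
        refine Finset.sum_le_sum fun x _ => ?_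
        rw [overlapGradient, ← mul_div_assoc, Finset.mul_sum]
        exact div_le_div_of_nonneg_right (Finset.sum_le_sum fun y _ => term_le x y)
          (Nat.cast_nonneg _)
    _ = 2 * (h * susceptibility H h g) := by
        simp only [← Finset.sum_div, ← Finset.mul_sum, susceptibility]
        rw [Finset.sum_comm]
        ring

/-- The last summand has mean zero, by integration by parts. -/
lemma mul_sq_meanOverlap_sub_le (hH : Supermodular H) (hh : 0 ≤ h) (q : ℝ) (g : V → ℝ) :
    h * (meanOverlap H h g - q) ^ 2 ≤ (1 + |q|) * |fieldEnergy H h g - h * (1 - q)| +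
      2 * (h * susceptibility H h g) / Fintype.card V +
        (fieldEnergy H h g * (meanOverlap H h g - q) -
          (h * (1 - meanOverlap H h g) * (meanOverlap H h g - q) +
            (∑ x, magnetization H h g x * overlapGradient H h x g) / Fintype.card V)) := by
  have product_le : -((fieldEnergy H h g - h * (1 - q)) * (meanOverlap H h g - q)) ≤
      (1 + |q|) * |fieldEnergy H h g - h * (1 - q)| := by
    refine (neg_le_abs _).trans ?_
    rw [abs_mul, mul_comm]
    gcongr
    exact abs_meanOverlap_sub_le H h g q
  linarith [sum_magnetization_mul_overlapGradient_le hH hh g]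

lemma mul_integral_sq_meanOverlap_sub_le [Nonempty V] (hH : Supermodular H) (hh : 0 ≤ h) (q : ℝ) :
    h * ∫ g, (meanOverlap H h g - q) ^ 2 ∂stdGaussianPi V ≤
      (1 + |q|) * ∫ g, |fieldEnergy H h g - h * (1 - q)| ∂stdGaussianPi V +
        2 * (h * ∫ g, susceptibility H h g ∂stdGaussianPi V) / Fintype.card V := by
  have sub_q_aesm :
      AEStronglyMeasurable (fun g => meanOverlap H h g - q) (stdGaussianPi V) :=
    ((continuous_meanOverlap H h).sub continuous_const).aestronglyMeasurable
  have sub_q_le := ae_of_all (stdGaussianPi V) (abs_meanOverlap_sub_le H h · q)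
  have integrable_left := (integrable_fieldEnergy H h).mul_bdd sub_q_aesm sub_q_le
  have integrable_right :=
    ((((integrable_const 1).sub (integrable_meanOverlap H h)).const_mul h).mul_bdd sub_q_aesm
      sub_q_le).add (integrable_magnetization_mul_overlapGradient H h)
  have integrable_abs := ((integrable_fieldEnergy H h).sub
    (integrable_const (h * (1 - q)))).abs.const_mul (1 + |q|)
  have integrable_χ := (((integrable_susceptibility H h).const_mul h).const_mul 2).div_const
    (Fintype.card V : ℝ)
  have integral_le := integral_mono_of_nonneg
    (ae_of_all _ fun g => mul_nonneg hh (sq_nonneg (meanOverlap H h g - q)))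
    ((integrable_abs.add integrable_χ).add (integrable_left.sub integrable_right))
    (ae_of_all _ (mul_sq_meanOverlap_sub_le hH hh q))
  rw [integral_add' (integrable_abs.add integrable_χ) (integrable_left.sub integrable_right),
    integral_add' integrable_abs integrable_χ, integral_sub' integrable_left integrable_right]
    at integral_le
  simp only [Pi.add_apply, Pi.sub_apply, integral_fieldEnergy_mul_meanOverlap_sub, sub_self,
    add_zero, integral_const_mul, integral_div] at integral_le
  exact integral_le

lemma integral_overlapSquareDeviation_le (hH : Supermodular H) (q : ℝ) :
    ∫ g, overlapSquareDeviation H h g q ∂stdGaussianPi V ≤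
      ∫ g, (meanOverlap H h g - q) ^ 2 ∂stdGaussianPi V +
        2 * (∫ g, susceptibility H h g ∂stdGaussianPi V) / Fintype.card V := by
  have integrable_sq : Integrable (fun g => (meanOverlap H h g - q) ^ 2) (stdGaussianPi V) :=
    integrable_stdGaussianPi_of_abs_le (C := (1 + |q|) ^ 2)
      (((continuous_meanOverlap H h).sub continuous_const).pow 2) fun g => by
        rw [abs_pow]
        gcongr
        exact abs_meanOverlap_sub_le H h g q
  have integrable_χ := ((integrable_susceptibility H h).const_mul 2).div_const
    (Fintype.card V : ℝ)
  refine (integral_mono_of_nonneg (ae_of_all _ fun g => overlapSquareDeviation_nonneg H h g q)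
    (integrable_sq.add integrable_χ)
    (ae_of_all _ fun g => overlapSquareDeviation_le h g hH q)).trans_eq ?_
  rw [integral_add' integrable_sq integrable_χ, integral_div, integral_const_mul]

lemma mul_integral_overlapSquareDeviation_le [Nonempty V] (hH : Supermodular H) (hh : 0 ≤ h)
    (q : ℝ) :
    h * ∫ g, overlapSquareDeviation H h g q ∂stdGaussianPi V ≤
      (1 + |q|) * ∫ g, |fieldEnergy H h g - h * (1 - q)| ∂stdGaussianPi V +
        4 * (Real.sqrt (Fintype.card V) / Fintype.card V) := by
  have susceptibility_le := div_le_div_of_nonneg_right (mul_integral_susceptibility_le H h)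
    (Nat.cast_nonneg (Fintype.card V))
  have deviation_le := mul_le_mul_of_nonneg_left
    (integral_overlapSquareDeviation_le (h := h) hH q) hh
  have overlap_le := mul_integral_sq_meanOverlap_sub_le hH hh q
  rw [mul_div_assoc] at overlap_le
  rw [mul_add, mul_div_assoc, mul_left_comm h 2, ← mul_div_assoc h] at deviation_le
  linarith

end IntegrationByParts

section QuenchedFreeEnergy

variable {V : Type*} [Fintype V] [DecidableEq V]

/-- The free energy per site, averaged over a standard Gaussian field. -/
noncomputable def quenchedFreeEnergy (H : (V → ℤˣ) → ℝ) (h : ℝ) : ℝ :=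
  ∫ g, freeEnergy H h g ∂stdGaussianPi V

lemma convexOn_freeEnergy (g : V → ℝ) :
    ConvexOn ℝ Set.univ fun z : ((V → ℤˣ) → ℝ) × ℝ => freeEnergy z.1 z.2 g := by
  refine ⟨convex_univ, fun z _ w _ s t hs ht hst => ?_⟩
  have energy_affine : energy (s • z + t • w).1 (s • z + t • w).2 g =
      s • energy z.1 z.2 g + t • energy w.1 w.2 g := by
    ext σ
    simp only [energy, Prod.fst_add, Prod.snd_add, Prod.smul_fst, Prod.smul_snd, Pi.add_apply,
      Pi.smul_apply, smul_eq_mul]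
    ring
  have convex := convexOn_logSumExp.2 (Set.mem_univ (energy z.1 z.2 g))
    (Set.mem_univ (energy w.1 w.2 g)) hs ht hst
  simp only [smul_eq_mul, freeEnergy] at convex ⊢
  rw [energy_affine, ← mul_div_assoc, ← mul_div_assoc, ← add_div]
  gcongr

lemma convexOn_quenchedFreeEnergy :
    ConvexOn ℝ Set.univ fun z : ((V → ℤˣ) → ℝ) × ℝ => quenchedFreeEnergy z.1 z.2 := by
  refine ⟨convex_univ, fun z hz w hw s t hs ht hst => ?_⟩
  have integrable_combination := ((integrable_freeEnergy z.1 z.2).const_mul s).add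
    ((integrable_freeEnergy w.1 w.2).const_mul t)
  refine (integral_mono (integrable_freeEnergy _ _) integrable_combination fun g =>
    (convexOn_freeEnergy g).2 hz hw hs ht hst).trans_eq ?_
  rw [integral_add' ((integrable_freeEnergy z.1 z.2).const_mul s)
    ((integrable_freeEnergy w.1 w.2).const_mul t), integral_const_mul, integral_const_mul]
  rfl

lemma abs_quenchedFreeEnergy_sub_le {H H' : (V → ℤˣ) → ℝ} {C : ℝ} (h : ℝ)
    (hC : ∀ σ, |H σ - H' σ| ≤ C) :
    |quenchedFreeEnergy H h - quenchedFreeEnergy H' h| ≤ C / Fintype.card V := by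
  have pointwise (g : V → ℝ) : ‖freeEnergy H h g - freeEnergy H' h g‖ ≤ C / Fintype.card V := by
    rw [freeEnergy, freeEnergy, ← sub_div, norm_div, RCLike.norm_natCast]
    gcongr
    exact abs_logSumExp_sub_le fun σ => by simpa only [energy, add_sub_add_right_eq_sub] using hC σ
  rw [quenchedFreeEnergy, quenchedFreeEnergy,
    ← integral_sub (integrable_freeEnergy H h) (integrable_freeEnergy H' h)]
  simpa using norm_integral_le_of_norm_le_const (μ := stdGaussianPi V) (ae_of_all _ pointwise)

lemma integral_abs_freeEnergy_sub_le (H : (V → ℤˣ) → ℝ) (h c : ℝ) :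
    ∫ g, |freeEnergy H h g - c| ∂stdGaussianPi V ≤
      |h| * (Real.sqrt (Fintype.card V) / Fintype.card V) + |quenchedFreeEnergy H h - c| := by
  have fluctuation := (l1Lipschitz_freeEnergy H h).integral_abs_sub_integral_le (by positivity)
  rw [div_mul_eq_mul_div, mul_div_assoc] at fluctuation
  have integrable_abs :
      Integrable (fun g => |freeEnergy H h g - quenchedFreeEnergy H h|) (stdGaussianPi V) :=
    ((integrable_freeEnergy H h).sub (integrable_const _)).abs
  calc ∫ g, |freeEnergy H h g - c| ∂stdGaussianPi V
      ≤ ∫ g, (|freeEnergy H h g - quenchedFreeEnergy H h| + |quenchedFreeEnergy H h - c|)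
          ∂stdGaussianPi V :=
        integral_mono_of_nonneg (ae_of_all _ fun g => abs_nonneg _)
          (integrable_abs.add (integrable_const _)) (ae_of_all _ fun g => abs_sub_le _ _ _)
    _ = ∫ g, |freeEnergy H h g - quenchedFreeEnergy H h| ∂stdGaussianPi V +
          |quenchedFreeEnergy H h - c| := by
        rw [integral_add integrable_abs (integrable_const _), integral_const, probReal_univ,
          one_smul]
    _ ≤ _ := add_le_add_left fluctuation _

end QuenchedFreeEnergy

lemma tendsto_sqrt_div_self_atTop : Tendsto (fun n : ℕ => Real.sqrt n / n) atTop (𝓝 0) := by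
  simp only [Real.sqrt_div_self]
  exact tendsto_inv_atTop_zero.comp (Real.tendsto_sqrt_atTop.comp tendsto_natCast_atTop_atTop)

section InfiniteVolume

variable {ι : Type*} {l : Filter ι} {V : ι → Type*} [∀ i, Fintype (V i)]
  [∀ i, DecidableEq (V i)] {H : ∀ i, (V i → ℤˣ) → ℝ} {p : ℝ → ℝ} {h : ℝ}

lemma tendsto_integral_abs_freeEnergy_sub
    (hV : Tendsto (fun i => Fintype.card (V i)) l atTop) (c : ℝ)
    (hlim : Tendsto (fun i => quenchedFreeEnergy (H i) h) l (𝓝 c)) :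
    Tendsto (fun i => ∫ g, |freeEnergy (H i) h g - c| ∂stdGaussianPi (V i)) l (𝓝 0) := by
  refine squeeze_zero (fun i => integral_nonneg fun g => abs_nonneg _)
    (fun i => integral_abs_freeEnergy_sub_le (H i) h c) ?_
  simpa using ((tendsto_sqrt_div_self_atTop.comp hV).const_mul |h|).add (hlim.sub_const c).abs

lemma tendsto_integral_abs_fieldEnergy_sub
    (hV : Tendsto (fun i => Fintype.card (V i)) l atTop)
    (hlim : ∀ t, Tendsto (fun i => quenchedFreeEnergy (H i) t) l (𝓝 (p t))) {L : ℝ}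
    (hp : HasDerivAt p L h) :
    Tendsto (fun i => ∫ g, |fieldEnergy (H i) h g - L| ∂stdGaussianPi (V i)) l (𝓝 0) :=
  tendsto_integral_abs_sub_of_subgradient (fun i t => integrable_freeEnergy (H i) t)
    (fun i => integrable_fieldEnergy (H i) h)
    (fun i g t => mul_fieldEnergy_le_freeEnergy_sub (H i) h g t)
    (fun t => tendsto_integral_abs_freeEnergy_sub hV (p t) (hlim t)) hp

lemma tendsto_integral_overlapSquareDeviation (hH : ∀ i, Supermodular (H i)) (hh : 0 < h)
    (hV : Tendsto (fun i => Fintype.card (V i)) l atTop) {q : ℝ}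
    (hlim : Tendsto (fun i => ∫ g, |fieldEnergy (H i) h g - h * (1 - q)| ∂stdGaussianPi (V i)) l
      (𝓝 0)) :
    Tendsto (fun i => ∫ g, overlapSquareDeviation (H i) h g q ∂stdGaussianPi (V i)) l (𝓝 0) := by
  have bound_tendsto : Tendsto (fun i =>
      ((1 + |q|) * ∫ g, |fieldEnergy (H i) h g - h * (1 - q)| ∂stdGaussianPi (V i) +
        4 * (Real.sqrt (Fintype.card (V i)) / Fintype.card (V i))) / h) l (𝓝 0) := by
    simpa using ((hlim.const_mul (1 + |q|)).add
      ((tendsto_sqrt_div_self_atTop.comp hV).const_mul 4)).div_const h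
  refine squeeze_zero' (.of_forall fun i => integral_nonneg fun g =>
    overlapSquareDeviation_nonneg (H i) h g q) ?_ bound_tendsto
  filter_upwards [hV.eventually_gt_atTop 0] with i hi
  have : Nonempty (V i) := Fintype.card_pos_iff.1 hi
  rw [le_div_iff₀' hh]
  exact mul_integral_overlapSquareDeviation_le (hH i) hh.le q

lemma abs_le_one_of_tendsto_integral_overlapSquareDeviation [l.NeBot] {q : ℝ}
    (hq : Tendsto (fun i => ∫ g, overlapSquareDeviation (H i) h g q ∂stdGaussianPi (V i)) l
      (𝓝 0)) : |q| ≤ 1 := by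
  by_contra! one_lt
  have lower_bound (i : ι) :
      (|q| - 1) ^ 2 ≤ ∫ g, overlapSquareDeviation (H i) h g q ∂stdGaussianPi (V i) := by
    refine le_trans ?_ (integral_mono (integrable_const _)
      (integrable_overlapSquareDeviation (H i) h q) fun g =>
        sq_abs_sub_one_le_overlapSquareDeviation (H i) h g one_lt.le)
    rw [integral_const, probReal_univ, one_smul]
  exact (ge_of_tendsto' hq lower_bound).not_gt (pow_pos (sub_pos.2 one_lt) 2)

/-- The constant is `q = 1 - p'(h) / h`: by integration by parts, the mean `p'(h)` of the field
energy is `h` times one minus the mean overlap. -/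
theorem exists_tendsto_integral_overlapSquareDeviation [l.NeBot] (hH : ∀ i, Supermodular (H i))
    (hh : 0 < h) (hV : Tendsto (fun i => Fintype.card (V i)) l atTop)
    (hlim : ∀ t, Tendsto (fun i => quenchedFreeEnergy (H i) t) l (𝓝 (p t)))
    (hp : DifferentiableAt ℝ p h) :
    ∃ q ∈ Set.Icc (-1 : ℝ) 1, Tendsto
      (fun i => ∫ g, overlapSquareDeviation (H i) h g q ∂stdGaussianPi (V i)) l (𝓝 0) := by
  have field_lim := tendsto_integral_abs_fieldEnergy_sub hV hlim hp.hasDerivAt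
  have slope_eq : deriv p h = h * (1 - (1 - deriv p h / h)) := by field_simp; ring
  rw [slope_eq] at field_lim
  have overlap_lim := tendsto_integral_overlapSquareDeviation hH hh hV field_lim
  exact ⟨_, abs_le.1 (abs_le_one_of_tendsto_integral_overlapSquareDeviation overlap_lim),
    overlap_lim⟩

end InfiniteVolume

section IndependentBlocks

variable {B W V : Type*} [Fintype B] [Fintype W] [Fintype V] [DecidableEq W]
  [DecidableEq V]

lemma logSumExp_sum_comp {α : Type*} [Fintype α] [Nonempty α] (e : B × W ≃ V)
    (F : B → (W → α) → ℝ) :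
    logSumExp (fun σ : V → α => ∑ b, F b fun w => σ (e (b, w))) = ∑ b, logSumExp (F b) := by
  classical
  simp only [logSumExp]
  rw [← Real.log_prod fun b _ => (sum_exp_pos (F b)).ne', Finset.prod_univ_sum,
    Fintype.piFinset_univ]
  simp only [Real.exp_sum]
  congr 1
  exact Fintype.sum_equiv ((e.symm.arrowCongr (Equiv.refl α)).trans (Equiv.curry B W α)) _ _
    fun _ => rfl

variable (e : B × W ≃ V) (H : (W → ℤˣ) → ℝ) (h : ℝ)

lemma card_mul_freeEnergy_sum_comp [Nonempty B] (g : V → ℝ) :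
    Fintype.card B * freeEnergy (fun σ => ∑ b, H fun w => σ (e (b, w))) h g =
      ∑ b, freeEnergy H h fun w => g (e (b, w)) := by
  have energy_eq : energy (fun σ => ∑ b, H fun w => σ (e (b, w))) h g =
      fun σ => ∑ b, energy H h (fun w => g (e (b, w))) fun w => σ (e (b, w)) := by
    ext σ
    simp only [energy, Finset.sum_add_distrib, ← Finset.mul_sum, ← Equiv.sum_comp e,
      Fintype.sum_prod_type, spin]
  have card_eq : (Fintype.card V : ℝ) = Fintype.card B * Fintype.card W := by
    rw [← Fintype.card_congr e, Fintype.card_prod, Nat.cast_mul]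
  simp only [freeEnergy, energy_eq]
  rw [logSumExp_sum_comp e fun b => energy H h fun w => g (e (b, w)), ← Finset.sum_div, card_eq,
    ← mul_div_assoc, mul_div_mul_left _ _ (Nat.cast_ne_zero.2 Fintype.card_ne_zero)]

lemma quenchedFreeEnergy_sum_comp [Nonempty B] :
    quenchedFreeEnergy (fun σ => ∑ b, H fun w => σ (e (b, w))) h = quenchedFreeEnergy H h := by
  have slice_pres (b : B) : MeasurePreserving (fun g : V → ℝ => fun w => g (e (b, w)))
      (stdGaussianPi V) (stdGaussianPi W) :=
    measurePreserving_comp_of_injective _ (e.injective.comp (Prod.mk_right_injective b))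
  have slice_integrable (b : B) :
      Integrable (fun g => freeEnergy H h fun w => g (e (b, w))) (stdGaussianPi V) :=
    (slice_pres b).integrable_comp_of_integrable (integrable_freeEnergy H h)
  have slice_integral (b : B) : ∫ g, freeEnergy H h (fun w => g (e (b, w))) ∂stdGaussianPi V =
      quenchedFreeEnergy H h := by
    rw [quenchedFreeEnergy, ← (slice_pres b).map_eq, integral_map (slice_pres b).aemeasurable]
    rw [(slice_pres b).map_eq]
    exact (integrable_freeEnergy H h).aestronglyMeasurable
  have hB : (Fintype.card B : ℝ) ≠ 0 := Nat.cast_ne_zero.2 Fintype.card_ne_zero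
  refine mul_left_cancel₀ hB ?_
  rw [quenchedFreeEnergy, ← integral_const_mul]
  simp only [card_mul_freeEnergy_sum_comp]
  rw [integral_finsetSum _ fun b _ => slice_integrable b]
  simp only [slice_integral, Finset.sum_const, Finset.card_univ, nsmul_eq_mul]

end IndependentBlocks

end RandomField

namespace RFIM

section Model

variable {d n : ℕ}

/-- The interaction `∑ σ_x σ_y` over the bonds of the box. -/
noncomputable def interaction (σ : Config d n) : ℝ :=
  ∑ e ∈ (boxGraph d n).edgeFinset, bond σ e

lemma meanFreeEnergy_eq_quenchedFreeEnergy (β h : ℝ) :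
    meanFreeEnergy d n β h =
      RandomField.quenchedFreeEnergy (β • interaction : Config d n → ℝ) h := by
  rw [RandomField.quenchedFreeEnergy]
  simp only [RandomField.freeEnergy, Fintype.card_coe]
  rfl

lemma replicaAvg_eq_replicaMean (β h : ℝ) (g : box d n → ℝ) (f : Config d n → Config d n → ℝ) :
    replicaAvg β h g f = RandomField.replicaMean
      (RandomField.energy (β • interaction : Config d n → ℝ) h g) fun p => f p.1 p.2 := by
  have partition_eq : partitionFn β h g * partitionFn β h g = ∑ σ : Config d n, ∑ τ : Config d n,
      Real.exp (energy β h g σ) * Real.exp (energy β h g τ) := Finset.sum_mul_sum _ _ _ _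
  have energy_eq :
      RandomField.energy (β • interaction : Config d n → ℝ) h g = energy β h g := rfl
  simp only [replicaAvg, gibbs, div_mul_div_comm]
  simp only [RandomField.replicaMean, RandomField.gibbsMean_apply, Fintype.sum_prod_type,
    Real.exp_add, energy_eq, partition_eq, mul_div_assoc, Finset.sum_div]

lemma overlapDeviation_eq (β h q : ℝ) :
    overlapDeviation d n β h q = ∫ g, RandomField.overlapSquareDeviation
      (β • interaction : Config d n → ℝ) h g q ∂(RandomField.stdGaussianPi (box d n)) := by
  simp only [overlapDeviation, replicaAvg_eq_replicaMean, RandomField.overlapSquareDeviation,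
    RandomField.overlap, Fintype.card_coe, overlap]
  rfl

lemma units_mul_add_mul_le : ∀ a b a' b' : ℤˣ, (a : ℤ) * b + a' * b' ≤
    ((a ⊓ a' : ℤˣ) : ℤ) * (b ⊓ b' : ℤˣ) + ((a ⊔ a' : ℤˣ) : ℤ) * (b ⊔ b' : ℤˣ) := by
  decide

lemma supermodular_bond (e : Sym2 (box d n)) :
    RandomField.Supermodular fun σ : Config d n => bond σ e := by
  intro σ τ
  induction e using Sym2.ind with | _ x y =>
  simp only [bond, Sym2.lift_mk, spin, Pi.inf_apply, Pi.sup_apply]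
  exact_mod_cast units_mul_add_mul_le (σ x) (σ y) (τ x) (τ y)

lemma supermodular_smul_interaction {β : ℝ} (hβ : 0 ≤ β) :
    RandomField.Supermodular (β • interaction : Config d n → ℝ) := by
  intro σ τ
  simp only [Pi.smul_apply, smul_eq_mul, ← mul_add, interaction, ← Finset.sum_add_distrib]
  exact mul_le_mul_of_nonneg_left
    (Finset.sum_le_sum fun e _ => supermodular_bond e σ τ) hβ

lemma abs_bond (σ : Config d n) (e : Sym2 (box d n)) : |bond σ e| = 1 := by
  induction e using Sym2.ind with | _ x y =>
  have abs_spin (z : box d n) : |spin σ z| = 1 := RandomField.abs_spin z σ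
  simp only [bond, Sym2.lift_mk, abs_mul, abs_spin, one_mul]

lemma card_box (d n : ℕ) : (box d n).card = n ^ d := by
  simp [box, Fintype.card_piFinset]

lemma mem_box {x : Fin d → ℤ} : x ∈ box d n ↔ ∀ i, 1 ≤ x i ∧ x i ≤ n := by
  simp [box, Fintype.mem_piFinset]

lemma convexOn_meanFreeEnergy :
    ConvexOn ℝ Set.univ fun z : ℝ × ℝ => meanFreeEnergy d n z.1 z.2 := by
  simp only [meanFreeEnergy_eq_quenchedFreeEnergy]
  exact RandomField.convexOn_quenchedFreeEnergy.comp_linearMap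
    ((LinearMap.toSpanSingleton ℝ _ (interaction : Config d n → ℝ)).prodMap LinearMap.id)

end Model

section Blocks

lemma exists_eq_add_single_of_sum_abs_eq_one {ι : Type*} [Fintype ι] [DecidableEq ι]
    {x y : ι → ℤ} (h : ∑ i, |x i - y i| = 1) :
    ∃ i, y = x + Pi.single i 1 ∨ x = y + Pi.single i 1 := by
  obtain ⟨i, hi⟩ : ∃ i, x i ≠ y i := by
    by_contra! heq
    simp [heq] at h
  rw [← Finset.add_sum_erase _ _ (Finset.mem_univ i)] at h
  have one_le : 1 ≤ |x i - y i| := Int.one_le_abs (sub_ne_zero.2 hi)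
  have rest_nonneg : 0 ≤ ∑ j ∈ Finset.univ.erase i, |x j - y j| :=
    Finset.sum_nonneg fun _ _ => abs_nonneg _
  have rest_eq (j : ι) (hj : j ≠ i) : x j = y j := by
    have := (Finset.sum_eq_zero_iff_of_nonneg fun _ _ => abs_nonneg _).1
      (by omega : ∑ j ∈ Finset.univ.erase i, |x j - y j| = 0) j
      (Finset.mem_erase.2 ⟨hj, Finset.mem_univ j⟩)
    exact sub_eq_zero.1 (abs_eq_zero.1 this)
  refine ⟨i, ((abs_eq zero_le_one).1 (by omega : |x i - y i| = 1)).symm.imp ?_ ?_⟩ <;>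
    refine fun hdiff => funext fun j => ?_ <;> rcases eq_or_ne j i with rfl | hj
  · simp only [Pi.add_apply, Pi.single_eq_same]; omega
  · simp [hj, rest_eq j hj]
  · simp only [Pi.add_apply, Pi.single_eq_same]; omega
  · simp [hj, rest_eq j hj]

lemma exists_eq_add_single_of_mem_edgeFinset {d n : ℕ} {e : Sym2 (box d n)}
    (he : e ∈ (boxGraph d n).edgeFinset) :
    ∃ i x y, e = s(x, y) ∧ y.1 = x.1 + Pi.single i 1 := by
  induction e using Sym2.ind with | _ x y =>
  rw [SimpleGraph.mem_edgeFinset, SimpleGraph.mem_edgeSet] at he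
  obtain ⟨i, hi | hi⟩ := exists_eq_add_single_of_sum_abs_eq_one he
  · exact ⟨i, x, y, rfl, hi⟩
  · exact ⟨i, y, x, Sym2.eq_swap, hi⟩

lemma card_filter_apply_eq_mul_le (d n : ℕ) (i : Fin d) (c : ℤ) :
    (Finset.univ.filter fun x : box d n => x.1 i = c).card * n ≤ n ^ d := by
  calc _ = ((Finset.univ.filter fun x : box d n => x.1 i = c) ×ˢ Finset.Icc (1 : ℤ) n).card := by
        rw [Finset.card_product, Int.card_Icc, add_sub_cancel_right, Int.toNat_natCast]
    _ ≤ (box d n).card :=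
        Finset.card_le_card_of_injOn (fun p => Function.update p.1.1 i p.2) ?_ ?_
    _ = n ^ d := card_box d n
  · rintro ⟨x, t⟩ hp
    have ht := Finset.mem_Icc.1 (Finset.mem_product.1 hp).2
    refine Finset.mem_coe.2 (mem_box.2 fun j => ?_)
    rcases eq_or_ne j i with rfl | hj
    · simpa using ht
    · simpa [hj] using mem_box.1 x.2 j
  · rintro ⟨x, t⟩ hp ⟨x', t'⟩ hp' heq
    have hx : x.1 i = c := by simpa using (Finset.mem_product.1 hp).1
    have hx' : x'.1 i = c := by simpa using (Finset.mem_product.1 hp').1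
    refine Prod.ext (Subtype.ext (funext fun j => ?_)) (by simpa using congrFun heq i)
    rcases eq_or_ne j i with rfl | hj
    · exact hx.trans hx'.symm
    · simpa [hj] using congrFun heq j

lemma blockIndex_le {m y y' z z' : ℤ} (hm : 0 ≤ m) (hz : 1 ≤ z) (hz' : z' ≤ m)
    (h : y * m + z ≤ y' * m + z') : y ≤ y' := by
  by_contra! hlt
  have : (y' + 1) * m ≤ y * m := mul_le_mul_of_nonneg_right hlt hm
  linarith

variable {d k m : ℕ}

/-- The box of side `k * m` is tiled by `k ^ d` blocks of side `m`: this is its site with offset `z`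
in the block with index `y`, for `p = (y, z)`. Block indices start at `0` and offsets at `1`. -/
def blockSite (p : (Fin d → Fin k) × box d m) : box d (k * m) :=
  ⟨fun i => (p.1 i : ℕ) * (m : ℤ) + p.2.1 i, mem_box.2 fun i => by
    have hz := mem_box.1 p.2.2 i
    have lower : (0 : ℤ) ≤ ((p.1 i : ℕ) : ℤ) * m := by positivity
    have upper : (((p.1 i : ℕ) : ℤ) + 1) * m ≤ k * m :=
      mul_le_mul_of_nonneg_right (by have := (p.1 i).2; omega) (by positivity)
    push_cast
    constructor <;> linarith⟩

lemma blockSite_apply (p : (Fin d → Fin k) × box d m) (i : Fin d) :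
    (blockSite p).1 i = (p.1 i : ℕ) * (m : ℤ) + p.2.1 i := rfl

lemma blockIndex_le_of_blockSite_le {p p' : (Fin d → Fin k) × box d m} {i : Fin d}
    (h : (blockSite p).1 i ≤ (blockSite p').1 i) : p.1 i ≤ p'.1 i := by
  rw [blockSite_apply, blockSite_apply] at h
  exact_mod_cast blockIndex_le (Nat.cast_nonneg m) (mem_box.1 p.2.2 i).1 (mem_box.1 p'.2.2 i).2 h

lemma blockIndex_eq_of_blockSite_eq {p p' : (Fin d → Fin k) × box d m} {i : Fin d}
    (h : (blockSite p).1 i = (blockSite p').1 i) : p.1 i = p'.1 i :=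
  le_antisymm (blockIndex_le_of_blockSite_le h.le) (blockIndex_le_of_blockSite_le h.ge)

lemma blockSite_injective : Function.Injective (blockSite (d := d) (k := k) (m := m)) := by
  intro p p' heq
  have coord_eq (i : Fin d) : (blockSite p).1 i = (blockSite p').1 i := by rw [heq]
  have index_eq : p.1 = p'.1 := funext fun i => blockIndex_eq_of_blockSite_eq (coord_eq i)
  refine Prod.ext index_eq (Subtype.ext (funext fun i => ?_))
  simpa only [blockSite_apply, index_eq, add_right_inj] using coord_eq i

lemma blockSite_bijective : Function.Bijective (blockSite (d := d) (k := k) (m := m)) := by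
  refine (Fintype.bijective_iff_injective_and_card _).2 ⟨blockSite_injective, ?_⟩
  simp only [Fintype.card_prod, Fintype.card_coe, card_box, Fintype.card_fun, Fintype.card_fin,
    mul_pow]

lemma adj_blockSite_iff (y : Fin d → Fin k) (z z' : box d m) :
    (boxGraph d (k * m)).Adj (blockSite (y, z)) (blockSite (y, z')) ↔
      (boxGraph d m).Adj z z' := by
  simp only [boxGraph, blockSite_apply, add_sub_add_left_eq_sub]

/-- The image in the large box of a bond of the block with index `p.1`. -/
def blockBond (p : (Fin d → Fin k) × Sym2 (box d m)) : Sym2 (box d (k * m)) :=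
  p.2.map fun z => blockSite (p.1, z)

lemma bond_blockBond (σ : Config d (k * m)) (p : (Fin d → Fin k) × Sym2 (box d m)) :
    bond σ (blockBond p) = bond (fun z => σ (blockSite (p.1, z))) p.2 := by
  obtain ⟨y, e⟩ := p
  induction e using Sym2.ind with | _ z z' => rfl

lemma blockBond_injective : Function.Injective (blockBond (d := d) (k := k) (m := m)) := by
  rintro ⟨y, e⟩ ⟨y', e'⟩ heq
  have block_injective (y : Fin d → Fin k) : Function.Injective fun z : box d m =>
      blockSite (y, z) := blockSite_injective.comp (Prod.mk_right_injective y)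
  have index_eq : y = y' := by
    induction e using Sym2.ind with | _ z z' =>
    induction e' using Sym2.ind with | _ w w' =>
    have hmem : blockSite (y, z) ∈ blockBond (y', s(w, w')) := heq ▸ Sym2.mem_mk_left _ _
    obtain ⟨u, -, hu⟩ := Sym2.mem_map.1 hmem
    exact (congrArg Prod.fst (blockSite_injective hu)).symm
  subst index_eq
  exact Prod.ext rfl (Sym2.map.injective (block_injective y) heq)

/-- The bonds inside the blocks that tile the large box. -/
noncomputable def interiorBonds (d k m : ℕ) : Finset (Sym2 (box d (k * m))) :=
  (Finset.univ ×ˢ (boxGraph d m).edgeFinset).map ⟨blockBond, blockBond_injective⟩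

lemma blockBond_mem_interiorBonds {y : Fin d → Fin k} {e : Sym2 (box d m)}
    (he : e ∈ (boxGraph d m).edgeFinset) : blockBond (y, e) ∈ interiorBonds d k m :=
  Finset.mem_map_of_mem _ (Finset.mem_product.2 ⟨Finset.mem_univ y, he⟩)

lemma interiorBonds_subset : interiorBonds d k m ⊆ (boxGraph d (k * m)).edgeFinset := by
  intro e he
  obtain ⟨⟨y, e'⟩, he', rfl⟩ := Finset.mem_map.1 he
  induction e' using Sym2.ind with | _ z z' =>
  have hadj : (boxGraph d m).Adj z z' := by simpa using he'
  exact SimpleGraph.mem_edgeFinset.2 ((adj_blockSite_iff y z z').2 hadj)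

lemma sum_interiorBonds (σ : Config d (k * m)) :
    ∑ e ∈ interiorBonds d k m, bond σ e =
      ∑ y, interaction fun z : box d m => σ (blockSite (y, z)) := by
  simp only [interiorBonds, Finset.sum_map, Function.Embedding.coeFn_mk, bond_blockBond,
    Finset.sum_product, interaction]

/-- The bonds between different blocks. -/
noncomputable def crossingBonds (d k m : ℕ) : Finset (Sym2 (box d (k * m))) :=
  (boxGraph d (k * m)).edgeFinset \ interiorBonds d k m

/-- A bond between neighbouring blocks leaves the first one through the face of sites with maximal
offset `m` in the direction of the bond. -/
lemma exists_of_mem_crossingBonds {e : Sym2 (box d (k * m))} (he : e ∈ crossingBonds d k m) :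
    ∃ i, ∃ p : (Fin d → Fin k) × box d m, p.2.1 i = m ∧
      e.map Subtype.val = s((blockSite p).1, (blockSite p).1 + Pi.single i 1) := by
  obtain ⟨hedge, hnot⟩ := Finset.mem_sdiff.1 he
  obtain ⟨i, x, x', rfl, hx⟩ := exists_eq_add_single_of_mem_edgeFinset hedge
  obtain ⟨p, rfl⟩ := blockSite_bijective.2 x
  obtain ⟨p', rfl⟩ := blockSite_bijective.2 x'
  refine ⟨i, p, ?_, by rw [← hx]; rfl⟩
  have index_ne : p.1 ≠ p'.1 := by
    obtain ⟨y, z⟩ := p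
    obtain ⟨y', z'⟩ := p'
    rintro rfl
    have hadj := (adj_blockSite_iff y z z').1
      (SimpleGraph.mem_edgeFinset.1 hedge)
    have interior : blockBond (y, s(z, z')) ∈ interiorBonds d k m :=
      blockBond_mem_interiorBonds (SimpleGraph.mem_edgeFinset.2 hadj)
    exact hnot interior
  have coord_eq (j : Fin d) (hj : j ≠ i) : p.1 j = p'.1 j :=
    blockIndex_eq_of_blockSite_eq (by simp [hx, hj])
  have coord_succ : (blockSite p').1 i = (blockSite p).1 i + 1 := by simp [hx]
  have index_lt : p.1 i < p'.1 i :=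
    (blockIndex_le_of_blockSite_le (by omega)).lt_of_ne fun heq => index_ne <| funext fun j => by
      rcases eq_or_ne j i with rfl | hj
      exacts [heq, coord_eq j hj]
  have next_block : (((p.1 i : ℕ) : ℤ) + 1) * m ≤ ((p'.1 i : ℕ) : ℤ) * m :=
    mul_le_mul_of_nonneg_right (by exact_mod_cast index_lt) (Nat.cast_nonneg m)
  have := (mem_box.1 p.2.2 i).2
  have := (mem_box.1 p'.2.2 i).1
  rw [blockSite_apply, blockSite_apply] at coord_succ
  linarith

lemma card_crossingBonds_mul_le : (crossingBonds d k m).card * m ≤ d * (k * m) ^ d := by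
  set face : Fin d → Finset ((Fin d → Fin k) × box d m) := fun i =>
    Finset.univ ×ˢ Finset.univ.filter fun z : box d m => z.1 i = (m : ℤ)
  have card_le : (crossingBonds d k m).card ≤ (Finset.univ.sigma face).card := by
    refine (Finset.card_le_card_of_injOn (Sym2.map Subtype.val) (fun e he => ?_)
      (Sym2.map.injective Subtype.val_injective).injOn).trans (Finset.card_image_le
        (f := fun q => s((blockSite q.2).1, (blockSite q.2).1 + Pi.single q.1 1)))
    obtain ⟨i, p, hp, heq⟩ := exists_of_mem_crossingBonds he
    exact Finset.mem_image.2 ⟨⟨i, p⟩, by simpa [face] using hp, heq.symm⟩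
  have face_card (i : Fin d) : (face i).card * m ≤ (k * m) ^ d := by
    rw [Finset.card_product, mul_assoc, mul_pow]
    exact Nat.mul_le_mul (by simp) (card_filter_apply_eq_mul_le d m i m)
  calc (crossingBonds d k m).card * m ≤ ∑ i, (face i).card * m := by
        rw [← Finset.sum_mul, ← Finset.card_sigma]
        gcongr
    _ ≤ ∑ _i : Fin d, (k * m) ^ d := Finset.sum_le_sum fun i _ => face_card i
    _ = d * (k * m) ^ d := by simp

lemma abs_interaction_sub_sum_le (σ : Config d (k * m)) :
    |interaction σ - ∑ y, interaction fun z : box d m => σ (blockSite (y, z))| ≤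
      (crossingBonds d k m).card := by
  rw [← sum_interiorBonds, interaction, ← Finset.sum_sdiff interiorBonds_subset,
    add_sub_cancel_right]
  refine (Finset.abs_sum_le_sum_abs _ _).trans_eq ?_
  simp only [abs_bond, Finset.sum_const, nsmul_eq_mul, mul_one, crossingBonds]

lemma abs_meanFreeEnergy_mul_sub_le (d : ℕ) {k m : ℕ} (hk : 0 < k) (hm : 0 < m) (β h : ℝ) :
    |meanFreeEnergy d (k * m) β h - meanFreeEnergy d m β h| ≤ |β| * d / m := by
  have : NeZero k := ⟨hk.ne'⟩
  have hcard : (0 : ℝ) < ((k * m : ℕ) : ℝ) ^ d := by positivity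
  have crossing_le : ((crossingBonds d k m).card : ℝ) / ((k * m : ℕ) : ℝ) ^ d ≤ d / m := by
    rw [div_le_div_iff₀ hcard (Nat.cast_pos.2 hm)]
    exact_mod_cast card_crossingBonds_mul_le (d := d) (k := k) (m := m)
  have decoupled := RandomField.quenchedFreeEnergy_sum_comp
    (Equiv.ofBijective _ (blockSite_bijective (d := d) (k := k) (m := m)))
    (β • interaction : Config d m → ℝ) h
  rw [meanFreeEnergy_eq_quenchedFreeEnergy, meanFreeEnergy_eq_quenchedFreeEnergy, ← decoupled]
  refine (RandomField.abs_quenchedFreeEnergy_sub_le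
    (C := |β| * (crossingBonds d k m).card) h fun σ => ?_).trans ?_
  · simp only [Pi.smul_apply, smul_eq_mul, ← Finset.mul_sum, ← mul_sub, abs_mul,
      Equiv.ofBijective_apply]
    gcongr
    exact abs_interaction_sub_sum_le σ
  · rw [Fintype.card_coe, card_box, Nat.cast_pow, mul_div_assoc, mul_div_assoc]
    gcongr

lemma exists_tendsto_meanFreeEnergy (d : ℕ) (β h : ℝ) :
    ∃ p, Tendsto (fun n : ℕ => meanFreeEnergy d n β h) atTop (𝓝 p) := by
  refine cauchySeq_tendsto_of_complete (Metric.cauchySeq_iff'.2 fun ε hε => ?_)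
  obtain ⟨N, hN⟩ := exists_nat_gt (2 * (|β| * d) / ε)
  have hN0 : (0 : ℝ) < N := lt_of_le_of_lt (by positivity) hN
  refine ⟨N, fun n hn => ?_⟩
  have hN_pos : 0 < N := Nat.cast_pos.1 hN0
  have hn_pos : 0 < n := hN_pos.trans_le hn
  have small : |β| * d / n + |β| * d / N < ε := by
    calc |β| * d / n + |β| * d / N ≤ |β| * d / N + |β| * d / N := by gcongr
      _ = 2 * (|β| * d) / N := by ring
      _ < ε := (div_lt_comm₀ hε hN0).1 hN
  have to_N := abs_meanFreeEnergy_mul_sub_le d hn_pos hN_pos β h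
  have to_n := abs_meanFreeEnergy_mul_sub_le d hN_pos hn_pos β h
  rw [mul_comm N n, abs_sub_comm] at to_n
  rw [Real.dist_eq]
  exact (abs_sub_le _ (meanFreeEnergy d (n * N) β h) _).trans_lt (by linarith)

end Blocks

section Limit

/-- The limiting free energy per site. -/
noncomputable def limitFreeEnergy (d : ℕ) (β h : ℝ) : ℝ :=
  (exists_tendsto_meanFreeEnergy d β h).choose

lemma tendsto_meanFreeEnergy (d : ℕ) (β h : ℝ) :
    Tendsto (fun n : ℕ => meanFreeEnergy d n β h) atTop (𝓝 (limitFreeEnergy d β h)) :=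
  (exists_tendsto_meanFreeEnergy d β h).choose_spec

lemma convexOn_limitFreeEnergy (d : ℕ) :
    ConvexOn ℝ Set.univ fun z : ℝ × ℝ => limitFreeEnergy d z.1 z.2 :=
  ⟨convex_univ, fun z hz w hw _ _ hs ht hst =>
    le_of_tendsto_of_tendsto' (tendsto_meanFreeEnergy d _ _)
      (((tendsto_meanFreeEnergy d z.1 z.2).const_smul _).add
        ((tendsto_meanFreeEnergy d w.1 w.2).const_smul _))
      fun _ => convexOn_meanFreeEnergy.2 hz hw hs ht hst⟩

lemma convexOn_limitFreeEnergy_right (d : ℕ) (β : ℝ) :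
    ConvexOn ℝ Set.univ (limitFreeEnergy d β) := by
  refine ⟨convex_univ, fun a _ b _ s t hs ht hst => ?_⟩
  have := (convexOn_limitFreeEnergy d).2 (Set.mem_univ (β, a)) (Set.mem_univ (β, b)) hs ht hst
  simpa [← add_mul, hst] using this

lemma continuous_limitFreeEnergy (d : ℕ) :
    Continuous (Function.uncurry (limitFreeEnergy d)) :=
  continuousOn_univ.1 ((convexOn_limitFreeEnergy d).continuousOn isOpen_univ)

/-- The exceptional set: the positive parameters at which the limiting free energy is not
differentiable in the field strength. -/
def singularSet (d : ℕ) : Set (ℝ × ℝ) :=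
  {z | 0 < z.1 ∧ 0 < z.2 ∧ ¬ DifferentiableAt ℝ (fun t : ℝ => limitFreeEnergy d z.1 t) z.2}

lemma countable_singularSet_section (d : ℕ) (β : ℝ) :
    {h : ℝ | (β, h) ∈ singularSet d}.Countable :=
  (RandomField.countable_not_differentiableAt_of_convexOn
    (convexOn_limitFreeEnergy_right d β)).mono fun _ hh => hh.2.2

lemma measurableSet_singularSet (d : ℕ) : MeasurableSet (singularSet d) :=
  (measurableSet_lt measurable_const measurable_fst).inter
    ((measurableSet_lt measurable_const measurable_snd).inter
      (measurableSet_of_differentiableAt_with_param ℝ (continuous_limitFreeEnergy d)).compl)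

lemma volume_singularSet (d : ℕ) : volume (singularSet d) = 0 := by
  rw [Measure.volume_eq_prod, Measure.measure_prod_null (measurableSet_singularSet d)]
  exact ae_of_all _ fun β => (countable_singularSet_section d β).measure_zero volume

lemma exists_tendsto_overlapDeviation {d : ℕ} (hd : d ≠ 0) {β h : ℝ} (hβ : 0 ≤ β) (hh : 0 < h)
    (hdiff : DifferentiableAt ℝ (limitFreeEnergy d β) h) :
    ∃ q ∈ Set.Icc (-1 : ℝ) 1,
      Tendsto (fun n : ℕ => overlapDeviation d n β h q) atTop (𝓝 0) := by
  have card_tendsto : Tendsto (fun n : ℕ => Fintype.card (box d n)) atTop atTop := by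
    simpa only [Fintype.card_coe, card_box] using tendsto_pow_atTop hd
  have free_energy_tendsto := tendsto_meanFreeEnergy d β
  simp only [meanFreeEnergy_eq_quenchedFreeEnergy] at free_energy_tendsto
  simp only [overlapDeviation_eq]
  exact RandomField.exists_tendsto_integral_overlapSquareDeviation
    (fun _ => supermodular_smul_interaction hβ) hh card_tendsto free_energy_tendsto hdiff

end Limit

end RFIM

theorem theorem1p1 (d : ℕ) (hd : 1 ≤ d) :
    ∃ (p : ℝ → ℝ → ℝ) (A : Set (ℝ × ℝ)),
      (∀ β h : ℝ, 0 < β → 0 < h →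
        Tendsto (fun n : ℕ => RFIM.meanFreeEnergy d n β h) atTop (𝓝 (p β h))) ∧
      A = {z : ℝ × ℝ | 0 < z.1 ∧ 0 < z.2 ∧ ¬ DifferentiableAt ℝ (fun t : ℝ => p z.1 t) z.2} ∧
      volume A = 0 ∧
      (∀ β : ℝ, {h : ℝ | (β, h) ∈ A}.Countable) ∧
      ∀ β h : ℝ, 0 < β → 0 < h → (β, h) ∉ A →
        ∃ q ∈ Set.Icc (-1 : ℝ) 1,
          Tendsto (fun n : ℕ => RFIM.overlapDeviation d n β h q) atTop (𝓝 0) := by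
  refine ⟨RFIM.limitFreeEnergy d, RFIM.singularSet d,
    fun β h _ _ => RFIM.tendsto_meanFreeEnergy d β h, rfl, RFIM.volume_singularSet d,
    RFIM.countable_singularSet_section d, fun β h hβ hh hA => ?_⟩
  have hdiff : DifferentiableAt ℝ (RFIM.limitFreeEnergy d β) h := by
    by_contra hnot
    exact hA ⟨hβ, hh, hnot⟩
  exact RFIM.exists_tendsto_overlapDeviation (by omega) hβ.le hh hdiff
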